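/- Let $G$ be a finite $2$-group whose center $Z$ is elementary abelian (every $z\in Z$ satisfies $z^2=1$), and let $x_1,\dots,x_n$ be an $\mathbb{F}_2$-basis of $H^1(Z;\mathbb{F}_2)$, so that $H^*(Z;\mathbb{F}_2)=\mathbb{F}_2[x_1,\dots,x_n]$. Let $l\ge 0$ be an integer and let $\mathcal{P}\subset H^*(G;\mathbb{F}_2)$ be a graded $\mathbb{F}_2$-subalgebra (one that contains the homogeneous components of each of its elements) which the restriction map $\mathrm{res}^G_Z\colon H^*(G;\mathbb{F}_2)\to H^*(Z;\mathbb{F}_2)$ maps isomorphically onto the polynomial subalgebra $\mathbb{F}_2[x_1^{2^l},\dots,x_n^{2^l}]\subset H^*(Z;\mathbb{F}_2)$; in particular $\mathcal{P}$ is a polynomial algebra. Then $H^*(G;\mathbb{F}_2)=\bigoplus_{k\ge 0}H^k(G;\mathbb{F}_2)$, with the cup product, is free as a module over $\mathcal{P}$. -/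

import Mathlib

open CategoryTheory

noncomputable section

namespace ModTwo

section Basic

/-- The trivial one-dimensional representation `𝔽₂` of `G`. -/
abbrev trivialRep (G : Type) [Group G] : Rep.{0} (ZMod 2) G := Rep.trivial (ZMod 2) G (ZMod 2)

/-- The mod 2 cohomology group `Hⁿ(G; 𝔽₂)` (Mathlib's group cohomology). -/
abbrev H (G : Type) [Group G] (n : ℕ) : Type := groupCohomology (trivialRep G) n

/-- Inhomogeneous `n`-cochains of `G` with values in `𝔽₂`. -/
abbrev Cochain (G : Type) (n : ℕ) : Type := (Fin n → G) → ZMod 2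

variable {G : Type}

/-- The cup product of cochains:
`(f ∪ g)(s₁, …, s_{p+q}) = f(s₁, …, s_p) * g(s_{p+1}, …, s_{p+q})`
(the action on the coefficients is trivial). -/
def cup {p q : ℕ} (f : Cochain G p) (g : Cochain G q) : Cochain G (p + q) :=
  fun s => f (fun i => s (Fin.castAdd q i)) * g (fun j => s (Fin.natAdd p j))

theorem cup_add {p q : ℕ} (f : Cochain G p) (g h : Cochain G q) :
    cup f (g + h) = cup f g + cup f h := by
  funext s; simp [cup, mul_add]

theorem add_cup {p q : ℕ} (f g : Cochain G p) (h : Cochain G q) :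
    cup (f + g) h = cup f h + cup g h := by
  funext s; simp [cup, add_mul]

theorem cup_smul {p q : ℕ} (r : ZMod 2) (f : Cochain G p) (g : Cochain G q) :
    cup f (r • g) = r • cup f g := by
  funext s; simp [cup, mul_left_comm]

theorem smul_cup {p q : ℕ} (r : ZMod 2) (f : Cochain G p) (g : Cochain G q) :
    cup (r • f) g = r • cup f g := by
  funext s; simp [cup, mul_assoc]

/-- A cochain evaluated on the first `n` terms of a sequence (this avoids casts between degrees). -/
def ext {n : ℕ} (f : Cochain G n) (s : ℕ → G) : ZMod 2 := f fun i => s i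

/-- Drop the first `p` terms of a sequence. -/
def shift (p : ℕ) (s : ℕ → G) : ℕ → G := fun i => s (p + i)

theorem ext_cup {p q : ℕ} (f : Cochain G p) (g : Cochain G q) (s : ℕ → G) :
    ext (cup f g) s = ext f s * ext g (shift p s) := by
  simp [ext, cup, shift]

end Basic

section Cup

variable {G : Type} [Group G]

/-- Multiply the `j`-th and `(j + 1)`-st terms of a sequence together. -/
def contract (j : ℕ) (s : ℕ → G) : ℕ → G := fun i =>
  if i < j then s i else if i = j then s i * s (i + 1) else s (i + 1)

/-- The differential of Mathlib's complex of inhomogeneous cochains. -/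
def d {n : ℕ} (f : Cochain G n) : Cochain G (n + 1) :=
  (inhomogeneousCochains.d (trivialRep G) n).hom f

theorem d_add {n : ℕ} (f g : Cochain G n) : d (f + g) = d f + d g := map_add _ f g

theorem d_smul {n : ℕ} (r : ZMod 2) (f : Cochain G n) : d (r • f) = r • d f := map_smul _ r f

theorem d_zero {n : ℕ} : d (0 : Cochain G n) = 0 := map_zero _

theorem ext_inj {n : ℕ} {f g : Cochain G n} (h : ∀ s, ext f s = ext g s) : f = g := by
  funext s
  have := h fun i => if hi : i < n then s ⟨i, hi⟩ else 1
  simpa [ext] using this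

theorem ext_d {n : ℕ} (f : Cochain G n) (s : ℕ → G) :
    ext (d f) s = ext f (shift 1 s) + ∑ j ∈ Finset.range (n + 1), ext f (contract j s) := by
  rw [Finset.sum_range]
  simp only [ext, d, inhomogeneousCochains.d_hom_apply]
  congr 1
  · simp [shift, add_comm]
  · refine Finset.sum_congr rfl fun j _ => ?_
    have : ((-1 : ZMod 2)) = 1 := by decide
    rw [this, one_pow, one_smul]
    congr 1

theorem ext_contract_add {n j : ℕ} (f : Cochain G n) (s : ℕ → G) (h : n ≤ j) :
    ext f (contract j s) = ext f s := by
  simp only [ext]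
  congr 1
  funext i
  simp [contract, lt_of_lt_of_le i.2 h]

/-- The Leibniz rule `d (f ∪ g) = d f ∪ g + f ∪ d g` (there are no signs mod 2). -/
theorem ext_d_cup {p q : ℕ} (f : Cochain G p) (g : Cochain G q) (s : ℕ → G) :
    ext (d (cup f g)) s =
      ext (d f) s * ext g (shift (p + 1) s) + ext f s * ext (d g) (shift p s) := by
  have hs : shift 1 (shift p s) = shift (p + 1) s := by
    funext i; simp [shift, add_assoc]
  have hs' : shift p (shift 1 s) = shift (p + 1) s := by
    funext i; simp only [shift]; congr 1; ring
  have h1 : ∀ j ∈ Finset.range p, ext (cup f g) (contract j s) =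
      ext f (contract j s) * ext g (shift (p + 1) s) := by
    intro j hj
    rw [ext_cup]
    congr 2
    funext i
    have := Finset.mem_range.1 hj
    simp only [shift, contract]
    rw [if_neg (by omega), if_neg (by omega)]
    congr 1; ring
  have h2 : ∀ j ∈ Finset.range (q + 1), ext (cup f g) (contract (p + j) s) =
      ext f s * ext g (contract j (shift p s)) := by
    intro j hj
    rw [ext_cup, ext_contract_add f s (by omega)]
    congr 2
    funext i
    simp [shift, contract, add_assoc]
  have h3 : ∀ a : ZMod 2, a + a = 0 := by decide
  rw [ext_d, ext_d, ext_d, add_assoc p q 1, Finset.sum_range_add, Finset.sum_congr rfl h1,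
    Finset.sum_congr rfl h2, Finset.sum_range_succ _ p, ext_contract_add f s le_rfl, ext_cup, hs, hs',
    ← Finset.sum_mul, ← Finset.mul_sum]
  linear_combination -(h3 (ext f s * ext g (shift (p + 1) s)))

theorem d_cup {p q : ℕ} {f : Cochain G p} {g : Cochain G q} (hf : d f = 0) (hg : d g = 0) :
    d (cup f g) = 0 := by
  refine ext_inj fun s => ?_
  rw [ext_d_cup, hf, hg]
  simp [ext]

/-- The cocycle given by a cochain with vanishing differential. -/
def mkCocycle {n : ℕ} (f : Cochain G n) (hf : d f = 0) :
    groupCohomology.cocycles (trivialRep G) n :=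
  groupCohomology.cocyclesMk f hf

theorem iCocycles_mkCocycle {n : ℕ} (f : Cochain G n) (hf : d f = 0) :
    groupCohomology.iCocycles (trivialRep G) n (mkCocycle f hf) = f := by
  unfold mkCocycle
  exact groupCohomology.iCocycles_mk (A := trivialRep G) (n := n) f hf

theorem cocycle_ext {n : ℕ} {x y : groupCohomology.cocycles (trivialRep G) n}
    (h : groupCohomology.iCocycles (trivialRep G) n x =
      groupCohomology.iCocycles (trivialRep G) n y) : x = y :=
  (ModuleCat.mono_iff_injective (groupCohomology.iCocycles (trivialRep G) n)).1 inferInstance h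

/-- The cohomology class of a cocycle. -/
def cls {n : ℕ} (f : Cochain G n) (hf : d f = 0) : H G n :=
  groupCohomology.π (trivialRep G) n (mkCocycle f hf)

theorem cls_surj {n : ℕ} (x : H G n) : ∃ (f : Cochain G n) (hf : d f = 0), cls f hf = x := by
  induction x using groupCohomology_induction_on with
  | h x =>
    have hx : d (groupCohomology.iCocycles (trivialRep G) n x) = 0 := by
      have h := ConcreteCategory.congr_hom
        ((groupCohomology.inhomogeneousCochains (trivialRep G)).iCycles_d n (n + 1)) x
      rw [groupCohomology.inhomogeneousCochains.d_def] at h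
      exact h
    exact ⟨groupCohomology.iCocycles (trivialRep G) n x, hx,
      congrArg (groupCohomology.π (trivialRep G) n) (cocycle_ext (iCocycles_mkCocycle _ hx))⟩

theorem cls_add {n : ℕ} {f g : Cochain G n} (hf : d f = 0) (hg : d g = 0) :
    cls (f + g) (by rw [d_add, hf, hg, add_zero]) = cls f hf + cls g hg := by
  unfold cls
  rw [← map_add]
  refine congrArg (groupCohomology.π (trivialRep G) n) (cocycle_ext ?_)
  rw [map_add, iCocycles_mkCocycle, iCocycles_mkCocycle, iCocycles_mkCocycle]

theorem cls_smul {n : ℕ} (r : ZMod 2) {f : Cochain G n} (hf : d f = 0) :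
    cls (r • f) (by rw [d_smul, hf, smul_zero]) = r • cls f hf := by
  unfold cls
  rw [← map_smul]
  refine congrArg (groupCohomology.π (trivialRep G) n) (cocycle_ext ?_)
  rw [map_smul, iCocycles_mkCocycle, iCocycles_mkCocycle]

/-- A coboundary: zero in degree `0`, and the differential of a cochain in positive degrees. -/
def IsCoboundary : ∀ {n : ℕ}, Cochain G n → Prop
  | 0, f => f = 0
  | _ + 1, f => ∃ e, d e = f

theorem isCoboundary_zero {n : ℕ} : IsCoboundary (0 : Cochain G n) := by
  cases n with
  | zero => rfl
  | succ n => exact ⟨0, d_zero⟩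

theorem isCoboundary_of_ext {m n : ℕ} (h : m + 1 = n) (e : Cochain G m) (f : Cochain G n)
    (hef : ∀ s, ext (d e) s = ext f s) : IsCoboundary f := by
  subst h
  exact ⟨e, ext_inj hef⟩

theorem cls_eq_zero_iff {n : ℕ} {f : Cochain G n} (hf : d f = 0) :
    cls f hf = 0 ↔ IsCoboundary f := by
  let K := groupCohomology.inhomogeneousCochains (trivialRep G)
  have key : ∀ i, (ComplexShape.up ℕ).prev n = i → (cls f hf = 0 ↔ ∃ e, K.d i n e = f) := by
    intro i hi
    have ex : (ShortComplex.mk _ _ (K.toCycles_comp_homologyπ i n)).Exact :=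
      ShortComplex.exact_of_g_is_cokernel _ (K.homologyIsCokernel i n hi)
    rw [ShortComplex.moduleCat_exact_iff] at ex
    constructor
    · intro h
      obtain ⟨e, he⟩ := ex _ h
      refine ⟨e, ?_⟩
      have h1 := ConcreteCategory.congr_hom (K.toCycles_i i n) e
      exact (h1.symm.trans (congrArg (K.iCycles n) he)).trans (iCocycles_mkCocycle f hf)
    · rintro ⟨e, he⟩
      have h1 : mkCocycle f hf = K.toCycles i n e := by
        refine cocycle_ext ?_
        rw [iCocycles_mkCocycle, ← he]
        exact (ConcreteCategory.congr_hom (K.toCycles_i i n) e).symm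
      unfold cls
      rw [h1]
      exact ConcreteCategory.congr_hom (K.toCycles_comp_homologyπ i n) e
  cases n with
  | zero =>
    rw [key 0 (by simp), K.shape _ _ (by simp)]
    simp [IsCoboundary, eq_comm]
  | succ n =>
    rw [key n (by simp), groupCohomology.inhomogeneousCochains.d_def]
    rfl

theorem IsCoboundary.cup_left {p q : ℕ} {f : Cochain G p} {g : Cochain G q}
    (hf : IsCoboundary f) (hg : d g = 0) : IsCoboundary (cup f g) := by
  cases p with
  | zero =>
    have hf : f = 0 := hf
    rw [hf, show cup (0 : Cochain G 0) g = 0 by funext s; simp [cup]]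
    exact isCoboundary_zero
  | succ p =>
    obtain ⟨e, rfl⟩ := hf
    refine isCoboundary_of_ext (by omega) (cup e g) _ fun s => ?_
    rw [ext_d_cup, hg, ext_cup]
    simp [ext]

theorem IsCoboundary.cup_right {p q : ℕ} {f : Cochain G p} {g : Cochain G q}
    (hf : d f = 0) (hg : IsCoboundary g) : IsCoboundary (cup f g) := by
  cases q with
  | zero =>
    have hg : g = 0 := hg
    rw [hg, show cup f (0 : Cochain G 0) = 0 by funext s; simp [cup]]
    exact isCoboundary_zero
  | succ q =>
    obtain ⟨e, rfl⟩ := hg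
    refine isCoboundary_of_ext (by omega) (cup f e) _ fun s => ?_
    rw [ext_d_cup, hf, ext_cup]
    simp [ext]

theorem cls_eq_iff {n : ℕ} {f g : Cochain G n} (hf : d f = 0) (hg : d g = 0) :
    cls f hf = cls g hg ↔ IsCoboundary (f + g) := by
  have h2 : ∀ x : H G n, x + x = 0 := fun x => by
    rw [← two_smul (ZMod 2) x, show (2 : ZMod 2) = 0 from rfl, zero_smul]
  rw [← cls_eq_zero_iff (by rw [d_add, hf, hg, add_zero]), cls_add hf hg]
  constructor
  · intro h; rw [h, h2]
  · intro h; rw [← add_zero (cls f hf), ← h2 (cls g hg), ← add_assoc, h, zero_add]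

/-- A cocycle representing a cohomology class. -/
def rep {n : ℕ} (x : H G n) : Cochain G n := (cls_surj x).choose

theorem d_rep {n : ℕ} (x : H G n) : d (rep x) = 0 := (cls_surj x).choose_spec.choose

theorem cls_rep {n : ℕ} (x : H G n) : cls (rep x) (d_rep x) = x :=
  (cls_surj x).choose_spec.choose_spec

/-- The cup product on cohomology. It is induced by the cup product of cocycles and does not
depend on the representatives, see `mul_cls`. -/
def mul {p q : ℕ} (x : H G p) (y : H G q) : H G (p + q) :=
  cls (cup (rep x) (rep y)) (d_cup (d_rep x) (d_rep y))

theorem mul_cls {p q : ℕ} {f : Cochain G p} {g : Cochain G q} (hf : d f = 0) (hg : d g = 0) :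
    mul (cls f hf) (cls g hg) = cls (cup f g) (d_cup hf hg) := by
  have ef := cls_rep (cls f hf)
  have eg := cls_rep (cls g hg)
  rw [cls_eq_iff] at ef eg
  have a : mul (cls f hf) (cls g hg) =
      cls (cup f (rep (cls g hg))) (d_cup hf (d_rep _)) := by
    rw [mul, cls_eq_iff, ← add_cup]
    exact ef.cup_left (d_rep _)
  rw [a, cls_eq_iff, ← cup_add]
  exact eg.cup_right hf

theorem d_one : d (fun _ => 1 : Cochain G 0) = 0 := by
  refine ext_inj fun s => ?_
  rw [ext_d]
  simp [ext]
  decide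

/-- The unit class in `H⁰(G; 𝔽₂)`, represented by the constant cochain `1`. -/
def one : H G 0 := cls (fun _ => 1) d_one

theorem mk_cls_eq {m n : ℕ} (h : m = n) {f : Cochain G m} {g : Cochain G n}
    (hf : d f = 0) (hg : d g = 0) (hfg : ∀ s, ext f s = ext g s) :
    GradedMonoid.mk (A := H G) m (cls f hf) = GradedMonoid.mk n (cls g hg) := by
  subst h
  obtain rfl := ext_inj hfg
  rfl

instance : GradedMonoid.GOne (H G) := ⟨one⟩

instance : GradedMonoid.GMul (H G) := ⟨mul⟩

/-- `H^*(G; 𝔽₂)` is a graded ring under the cup product. -/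
instance : DirectSum.GRing (H G) where
  mul_zero {p q} x := by
    obtain ⟨f, hf, rfl⟩ := cls_surj x
    change mul (cls f hf) 0 = 0
    rw [← (cls_eq_zero_iff (d_zero (G := G))).2 isCoboundary_zero, mul_cls, cls_eq_zero_iff]
    exact isCoboundary_zero.cup_right hf
  zero_mul {p q} y := by
    obtain ⟨f, hf, rfl⟩ := cls_surj y
    change mul 0 (cls f hf) = 0
    rw [← (cls_eq_zero_iff (d_zero (G := G))).2 isCoboundary_zero, mul_cls, cls_eq_zero_iff]
    exact isCoboundary_zero.cup_left hf
  mul_add {p q} x y z := by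
    obtain ⟨f, hf, rfl⟩ := cls_surj x
    obtain ⟨g, hg, rfl⟩ := cls_surj y
    obtain ⟨h, hh, rfl⟩ := cls_surj z
    change mul _ _ = mul _ _ + mul _ _
    simp only [← cls_add, mul_cls, cup_add]
  add_mul {p q} x y z := by
    obtain ⟨f, hf, rfl⟩ := cls_surj x
    obtain ⟨g, hg, rfl⟩ := cls_surj y
    obtain ⟨h, hh, rfl⟩ := cls_surj z
    change mul _ _ = mul _ _ + mul _ _
    simp only [← cls_add, mul_cls, add_cup]
  one_mul := by
    rintro ⟨p, x⟩
    obtain ⟨f, hf, rfl⟩ := cls_surj x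
    change GradedMonoid.mk (0 + p) (mul one (cls f hf)) = GradedMonoid.mk p (cls f hf)
    rw [one, mul_cls]
    refine mk_cls_eq (zero_add p) _ _ fun s => ?_
    rw [ext_cup]
    simp [ext, shift]
  mul_one := by
    rintro ⟨p, x⟩
    obtain ⟨f, hf, rfl⟩ := cls_surj x
    change GradedMonoid.mk (p + 0) (mul (cls f hf) one) = GradedMonoid.mk p (cls f hf)
    rw [one, mul_cls]
    refine mk_cls_eq (add_zero p) _ _ fun s => ?_
    rw [ext_cup]
    simp [ext]
  mul_assoc := by
    rintro ⟨p, x⟩ ⟨q, y⟩ ⟨r, z⟩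
    obtain ⟨f, hf, rfl⟩ := cls_surj x
    obtain ⟨g, hg, rfl⟩ := cls_surj y
    obtain ⟨h, hh, rfl⟩ := cls_surj z
    change GradedMonoid.mk (p + q + r) (mul (mul (cls f hf) (cls g hg)) (cls h hh)) =
      GradedMonoid.mk (p + (q + r)) (mul (cls f hf) (mul (cls g hg) (cls h hh)))
    rw [mul_cls, mul_cls, mul_cls, mul_cls]
    refine mk_cls_eq (add_assoc p q r) _ _ fun s => ?_
    simp only [ext_cup, mul_assoc]
    congr 3
    funext i
    simp [shift, add_assoc]
  natCast n := n • one
  natCast_zero := zero_smul _ _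
  natCast_succ n := succ_nsmul _ n
  intCast n := n • one
  intCast_ofNat n := natCast_zsmul _ n
  intCast_negSucc_ofNat n := negSucc_zsmul _ n

theorem smul_mul {p q : ℕ} (r : ZMod 2) (x : H G p) (y : H G q) :
    mul (r • x) y = r • mul x y := by
  obtain ⟨f, hf, rfl⟩ := cls_surj x
  obtain ⟨g, hg, rfl⟩ := cls_surj y
  simp only [← cls_smul, mul_cls, smul_cup]

theorem mul_smul {p q : ℕ} (r : ZMod 2) (x : H G p) (y : H G q) :
    mul x (r • y) = r • mul x y := by
  obtain ⟨f, hf, rfl⟩ := cls_surj x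
  obtain ⟨g, hg, rfl⟩ := cls_surj y
  simp only [← cls_smul, mul_cls, cup_smul]

theorem mk_smul {n : ℕ} (r : ZMod 2) (x : H G n) :
    GradedMonoid.mk (A := H G) n (r • x) = r • GradedMonoid.mk (A := H G) n x := rfl

/-- `H^*(G; 𝔽₂)` is a graded `𝔽₂`-algebra; the structure map is `r ↦ r • 1`. -/
instance : DirectSum.GAlgebra (ZMod 2) (H G) where
  toFun := (LinearMap.toSpanSingleton (ZMod 2) (H G 0) one).toAddMonoidHom
  map_one := one_smul _ _
  map_mul r s := by
    change GradedMonoid.mk (A := H G) 0 ((r * s) • one) =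
      GradedMonoid.mk (0 + 0) (mul (r • one) (s • one))
    rw [smul_mul, mul_smul, smul_smul, mk_smul, mk_smul]
    exact congrArg _ (one_mul (1 : GradedMonoid (H G))).symm
  commutes := by
    rintro r ⟨p, x⟩
    change GradedMonoid.mk (A := H G) (0 + p) (mul (r • one) x) =
      GradedMonoid.mk (p + 0) (mul x (r • one))
    rw [smul_mul, mul_smul, mk_smul, mk_smul]
    exact congrArg _ ((one_mul (GradedMonoid.mk (A := H G) p x)).trans (mul_one _).symm)
  smul_def := by
    rintro r ⟨p, x⟩
    change r • GradedMonoid.mk (A := H G) p x = GradedMonoid.mk (A := H G) (0 + p) (mul (r • one) x)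
    rw [smul_mul, mk_smul]
    exact congrArg _ (one_mul (GradedMonoid.mk (A := H G) p x)).symm

end Cup

/-- The mod 2 cohomology ring `H^*(G; 𝔽₂) = ⨁ₙ Hⁿ(G; 𝔽₂)`, an `𝔽₂`-algebra under cup product. -/
abbrev HStar (G : Type) [Group G] : Type := DirectSum ℕ (H G)

section Restriction

variable {G K : Type} [Group G] [Group K]

/-- The map `Hⁿ(G; 𝔽₂) → Hⁿ(K; 𝔽₂)` induced by a homomorphism `K → G`. -/
def mapDeg (φ : K →* G) (n : ℕ) : H G n →ₗ[ZMod 2] H K n :=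
  (groupCohomology.map (A := trivialRep G) (B := trivialRep K) φ (𝟙 (trivialRep K)) n).hom

theorem d_comp {n : ℕ} (φ : K →* G) {f : Cochain G n} (hf : d f = 0) :
    d (fun s => f (φ ∘ s) : Cochain K n) = 0 := by
  refine ext_inj fun s => ?_
  have h := congrArg (fun e => ext e (φ ∘ s)) hf
  rw [ext_d] at h
  rw [ext_d]
  refine Eq.trans ?_ h
  refine congrArg₂ _ rfl (Finset.sum_congr rfl fun j _ => congrArg f ?_)
  funext i
  simp only [Function.comp, contract]
  split_ifs <;> simp

theorem mapDeg_cls {n : ℕ} (φ : K →* G) {f : Cochain G n} (hf : d f = 0) :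
    mapDeg φ n (cls f hf) = cls (fun s => f (φ ∘ s)) (d_comp φ hf) := by
  have h := ConcreteCategory.congr_hom
    (groupCohomology.π_map (A := trivialRep G) (B := trivialRep K) φ (𝟙 (trivialRep K)) n)
    (mkCocycle f hf)
  refine h.trans (congrArg (groupCohomology.π (trivialRep K) n) (cocycle_ext ?_))
  rw [iCocycles_mkCocycle]
  have h2 := ConcreteCategory.congr_hom (HomologicalComplex.cyclesMap_i
    (groupCohomology.cochainsMap (A := trivialRep G) (B := trivialRep K) φ (𝟙 (trivialRep K))) n)
    (mkCocycle f hf)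
  refine h2.trans ?_
  change (groupCohomology.cochainsMap (A := trivialRep G) (B := trivialRep K) φ
    (𝟙 (trivialRep K))).f n (groupCohomology.iCocycles (trivialRep G) n (mkCocycle f hf)) = _
  rw [iCocycles_mkCocycle]
  rfl

/-- The homomorphism of cohomology rings `H^*(G; 𝔽₂) → H^*(K; 𝔽₂)` induced by `φ : K → G`; it is
`mapDeg φ n` in degree `n`. -/
def map (φ : K →* G) : HStar G →ₐ[ZMod 2] HStar K :=
  DirectSum.toAlgebra (ZMod 2) (H G)
    (fun n => (DirectSum.lof (ZMod 2) ℕ (H K) n).comp (mapDeg φ n))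
    (by
      change DirectSum.of (H K) 0 (mapDeg φ 0 one) = DirectSum.of (H K) 0 one
      rw [one, mapDeg_cls]
      rfl)
    (by
      intro p q x y
      obtain ⟨f, hf, rfl⟩ := cls_surj x
      obtain ⟨g, hg, rfl⟩ := cls_surj y
      change DirectSum.of (H K) (p + q) (mapDeg φ (p + q) (mul (cls f hf) (cls g hg))) =
        DirectSum.of (H K) p (mapDeg φ p (cls f hf)) * DirectSum.of (H K) q (mapDeg φ q (cls g hg))
      rw [DirectSum.of_mul_of]
      change _ = DirectSum.of (H K) (p + q) (mul _ _)
      rw [mul_cls, mapDeg_cls, mapDeg_cls, mapDeg_cls, mul_cls]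
      rfl)

theorem map_of (φ : K →* G) (n : ℕ) (x : H G n) :
    map φ (DirectSum.of (H G) n x) = DirectSum.of (H K) n (mapDeg φ n x) :=
  DirectSum.toAddMonoid_of
    (fun n => ((DirectSum.lof (ZMod 2) ℕ (H K) n).comp (mapDeg φ n)).toAddMonoidHom) n x

/-- The restriction homomorphism `H^*(G; 𝔽₂) → H^*(S; 𝔽₂)` to a subgroup `S` of `G`. -/
def res (S : Subgroup G) : HStar G →ₐ[ZMod 2] HStar S := map S.subtype

/-- A subalgebra of `H^*(G; 𝔽₂)` is graded if it contains the homogeneous components of each of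
its elements. -/
def IsGraded (P : Subalgebra (ZMod 2) (HStar G)) : Prop :=
  ∀ a ∈ P, ∀ n : ℕ, DirectSum.of (H G) n (a n) ∈ P

/-- For classes `x₁, …, xₙ` of degree one, the subalgebra `𝔽₂[x₁^{2^l}, …, xₙ^{2^l}]` of
`H^*(G; 𝔽₂)`. -/
def powerSubalgebra {n : ℕ} (x : Fin n → H G 1) (l : ℕ) : Subalgebra (ZMod 2) (HStar G) :=
  Algebra.adjoin (ZMod 2) (Set.range fun i => DirectSum.of (H G) 1 (x i) ^ 2 ^ l)

end Restriction

end ModTwo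

end

/-! Since `Z` is central, multiplication `μ : Z × G → G` is a homomorphism, and it is the identity
on the factor `G`. Put `θ = μ^*` and let `P` act on `H^*(Z × G)` through `θ`. Restriction to the
factor `G` is then a `P`-linear left inverse of `θ`, so `H^*(G)` is a direct summand of `H^*(Z ×
G)`. If the latter is free over `P`, then `H^*(G)` is projective, and a graded projective module
over a connected graded algebra is free (`free_of_projective`).

By Künneth, `H^*(Z × G) = H^*(G)[x₁, …, xₙ]` (`exists_basis_power`). For homogeneous `p ∈ P`, `θ p`
is the restriction of `p` to `Z` plus terms of positive degree in the factor `G`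
(`sub_ev_mem_filt`). With `q = 2^l`, polynomials are free over `𝔽₂[x₁^q, …, xₙ^q]` on the monomials
`x^β` with all exponents below `q`. So, up to terms of higher `G`-degree, `P` acts as on a free
module with basis `x^β b_k`, where the `b_k` form a homogeneous basis of `H^*(G)`. The `G`-degree is
bounded by the total degree, so this triangular comparison is invertible
(`Module.Free.of_triangular`).

The Künneth formula is proved on cochains, one factor of order two at a time. A prism homotopy shows
that the mapping cone of multiplication by the degree one class `x` of the new factor computes the
cohomology of the old group. Hence `x` is a nonzerodivisor, and every class of positive degree that
dies on the old group is a multiple of `x` (`IsSplit.cone_exact`). -/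

noncomputable section

namespace ModTwo

/-! ### The prism homotopy between the identity and an endomorphism -/

section Prism

theorem ext_congr {K : Type} {n : ℕ} (f : Cochain K n) {s s' : ℕ → K} (h : ∀ i < n, s i = s' i) :
    ext f s = ext f s' := by
  unfold ext
  congr 1
  funext i
  exact h i i.2

variable {K : Type} [Group K]

/-- The product of the first `j` terms of a sequence. -/
def prefixProd (s : ℕ → K) : ℕ → K
  | 0 => 1
  | j + 1 => prefixProd s j * s j

theorem prefixProd_succ' (s : ℕ → K) (j : ℕ) :
    prefixProd s (j + 1) = s 0 * prefixProd (shift 1 s) j := by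
  induction j with
  | zero => simp [prefixProd]
  | succ j ih =>
    rw [prefixProd, ih, prefixProd, mul_assoc]
    simp [shift, add_comm]

theorem prefixProd_congr {s s' : ℕ → K} {j : ℕ} (h : ∀ i < j, s i = s' i) :
    prefixProd s j = prefixProd s' j := by
  induction j with
  | zero => rfl
  | succ j ih =>
    rw [prefixProd, prefixProd, ih fun i hi => h i (by omega), h j (by omega)]

theorem prefixProd_contract_of_le (s : ℕ → K) {i j : ℕ} (h : j ≤ i) :
    prefixProd (contract i s) j = prefixProd s j :=
  prefixProd_congr fun m hm => by simp [contract, lt_of_lt_of_le hm h]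

theorem prefixProd_contract_of_lt (s : ℕ → K) {i j : ℕ} (h : i < j) :
    prefixProd (contract i s) j = prefixProd s (j + 1) := by
  induction j with
  | zero => omega
  | succ j ih =>
    rcases Nat.lt_succ_iff_lt_or_eq.1 h with h' | rfl
    · rw [prefixProd, ih h', prefixProd.eq_2 s (j + 1), contract, if_neg (by omega),
        if_neg (by omega)]
    · rw [prefixProd, prefixProd_contract_of_le s le_rfl, prefixProd, prefixProd, contract,
        if_neg (by omega), if_pos rfl, mul_assoc]

/-- The `j`-th simplex of the prism between a simplex and its image under `ρ`, in bar notation: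
the simplex has first vertex `k` and edges `s`. -/
def prism (ρ : K →* K) (j : ℕ) (k : K) (s : ℕ → K) : ℕ → K := fun i =>
  if i < j then s i else
    if i = j then (k * prefixProd s j)⁻¹ * ρ (k * prefixProd s j) else ρ (s (i - 1))

variable (ρ : K →* K) (k : K) (s : ℕ → K)

/-- Together with the next two lemmas, these are the simplicial identities of the prism: a face away
from the diagonal is a prism over a face of `s`, and neighbouring prisms share a diagonal face. -/
theorem contract_prism_of_lt {i j : ℕ} (h : i < j) :
    contract i (prism ρ (j + 1) k s) = prism ρ j k (contract i s) := by
  funext m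
  simp only [contract, prism, prefixProd_contract_of_lt s h]
  rcases lt_trichotomy m j with hm | rfl | hm
  · rw [if_pos hm, if_pos (show m < j + 1 by omega), if_pos (show m + 1 < j + 1 by omega)]
  · rw [if_neg (show ¬ m < i by omega), if_neg (show ¬ m = i by omega)]
    simp
  · rw [if_neg (show ¬ m < i by omega), if_neg (show ¬ m = i by omega),
      if_neg (show ¬ m + 1 < j + 1 by omega), if_neg (show ¬ m + 1 = j + 1 by omega),
      if_neg (show ¬ m < j by omega), if_neg (show ¬ m = j by omega),
      if_neg (show ¬ m - 1 < i by omega), if_neg (show ¬ m - 1 = i by omega)]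
    congr 2; omega

theorem contract_prism_of_le {i j : ℕ} (h : j ≤ i) :
    contract (i + 1) (prism ρ j k s) = prism ρ j k (contract i s) := by
  funext m
  simp only [contract, prism, prefixProd_contract_of_le s h]
  rcases lt_trichotomy m j with hm | rfl | hm
  · simp [hm, show m < i by omega, show m < i + 1 by omega]
  · simp [show m < i + 1 by omega]
  · rw [if_neg (show ¬ m < j by omega), if_neg (show ¬ m = j by omega),
      if_neg (show ¬ m + 1 < j by omega), if_neg (show ¬ m + 1 = j by omega),
      if_neg (show ¬ m < j by omega), if_neg (show ¬ m = j by omega)]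
    rcases lt_trichotomy m (i + 1) with hm' | rfl | hm'
    · rw [if_pos hm', if_pos (show m - 1 < i by omega)]
    · simp
    · rw [if_neg (show ¬ m < i + 1 by omega), if_neg (show ¬ m = i + 1 by omega),
        if_neg (show ¬ m - 1 < i by omega), if_neg (show ¬ m - 1 = i by omega)]
      congr 2; omega

theorem contract_prism_self (j : ℕ) :
    contract j (prism ρ (j + 1) k s) = contract j (prism ρ j k s) := by
  funext m
  simp only [contract, prism]
  rcases lt_trichotomy m j with hm | rfl | hm
  · simp [hm, show m < j + 1 by omega]
  · simp [prefixProd, mul_assoc]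
  · simp [show ¬ m < j by omega, show ¬ m = j by omega, show ¬ m + 1 < j by omega,
      show ¬ m + 1 = j by omega]

theorem shift_prism_zero : shift 1 (prism ρ 0 k s) = ρ ∘ s := by
  funext m
  simp [shift, prism, Nat.add_comm 1 m]

theorem mul_prism_zero : k * prism ρ 0 k s 0 = ρ k := by
  simp [prism, prefixProd]

theorem prism_succ_zero (j : ℕ) : prism ρ (j + 1) k s 0 = s 0 := by
  simp [prism]

theorem shift_prism_succ (j : ℕ) :
    shift 1 (prism ρ (j + 1) k s) = prism ρ j (k * s 0) (shift 1 s) := by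
  funext m
  simp only [shift, prism, prefixProd_succ', mul_assoc]
  rcases lt_trichotomy m j with hm | rfl | hm
  · simp [hm, show 1 + m < j + 1 by omega]
  · simp [Nat.add_comm 1 m]
  · simp only [show ¬ m < j by omega, show ¬ m = j by omega, show ¬ 1 + m < j + 1 by omega,
      show ¬ 1 + m = j + 1 by omega, if_false]
    congr 2; omega

theorem add_self_zmod (a : ZMod 2) : a + a = 0 := CharTwo.add_self_eq_zero a

/-- Here `a i j` stands for the `i`-th inner face of the `j`-th prism. The shared faces `a j (j +
1)` and `a j j` cancel mod 2 for `j < n`, which leaves only the last diagonal term `a n n`. -/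
theorem sum_prism_aux {a b : ℕ → ℕ → ZMod 2} (h1 : ∀ i j, i < j → a i (j + 1) = b i j)
    (h2 : ∀ i j, j ≤ i → a (i + 1) j = b i j) (h3 : ∀ j, a j (j + 1) = a j j) (n : ℕ) :
    ∑ j ∈ Finset.range (n + 1), ∑ i ∈ Finset.range (n + 1), a i j =
      ∑ j ∈ Finset.range n, ∑ i ∈ Finset.range n, b i j + a n n := by
  induction n with
  | zero => simp
  | succ n ih =>
    rw [Finset.sum_range_succ _ (n + 1)]
    simp only [Finset.sum_range_succ _ (n + 1)]
    rw [Finset.sum_add_distrib, ih, Finset.sum_range_succ (fun j => ∑ i ∈ Finset.range (n + 1), b i j) n]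
    simp only [Finset.sum_range_succ _ n]
    rw [Finset.sum_add_distrib, h3,
      Finset.sum_congr rfl fun i hi => h1 i n (Finset.mem_range.1 hi),
      Finset.sum_congr rfl fun j hj => h2 n j (Finset.mem_range.1 hj).le, h2 n n le_rfl]
    linear_combination add_self_zmod (a n n)

/-- A family of cochains `Φ k`, seen as a homogeneous cochain with first vertex `k`. -/
def dHom {n : ℕ} (Φ : K → Cochain K n) (k : K) (s : ℕ → K) : ZMod 2 :=
  ext (Φ (k * s 0)) (shift 1 s) + ∑ j ∈ Finset.range (n + 1), ext (Φ k) (contract j s)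

/-- The prism operator in degree `n`. -/
def prismOp {n : ℕ} (Φ : K → Cochain K (n + 1)) (k : K) : Cochain K n := fun s =>
  ∑ j ∈ Finset.range (n + 1), ext (Φ k) (prism ρ j k fun i => if h : i < n then s ⟨i, h⟩ else 1)

/-- The default value `1` in `prismOp` is harmless: for `j ≤ n` the first `n + 1` entries of the
prism involve only the first `n` terms of `s`. -/
theorem ext_prismOp {n : ℕ} (Φ : K → Cochain K (n + 1)) :
    ext (prismOp ρ Φ k) s = ∑ j ∈ Finset.range (n + 1), ext (Φ k) (prism ρ j k s) := by
  change ∑ j ∈ Finset.range (n + 1), _ = _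
  refine Finset.sum_congr rfl fun j hj => ext_congr _ fun i hi => ?_
  have hj := Finset.mem_range.1 hj
  have hp : prefixProd (fun i => if h : i < n then s i else 1) j = prefixProd s j :=
    prefixProd_congr fun i hi => dif_pos (by omega)
  simp only [prism, hp]
  rcases lt_trichotomy i j with hm | rfl | hm
  · rw [if_pos hm, if_pos hm, dif_pos (by omega)]
  · simp
  · rw [if_neg (by omega), if_neg (by omega), if_neg (by omega), if_neg (by omega),
      dif_pos (by omega)]

theorem sum_contract_prism {n : ℕ} (f : Cochain K n) :
    ∑ j ∈ Finset.range (n + 1), ∑ i ∈ Finset.range (n + 1), ext f (contract i (prism ρ j k s)) =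
      ∑ j ∈ Finset.range n, ∑ i ∈ Finset.range n, ext f (prism ρ j k (contract i s)) + ext f s := by
  rw [sum_prism_aux (b := fun i j => ext f (prism ρ j k (contract i s)))
    (fun i j h => by rw [contract_prism_of_lt ρ k s h])
    (fun i j h => by rw [contract_prism_of_le ρ k s h])
    (fun j => by rw [contract_prism_self])]
  congr 1
  rw [ext_contract_add f _ le_rfl]
  exact ext_congr f fun i hi => by simp [prism, hi]

/-- The prism operator is a homotopy between the identity and `ρ`. -/
theorem prism_homotopy {n : ℕ} (Φ : K → Cochain K (n + 1)) (h : ∀ k s, dHom Φ k s = 0) :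
    ext (Φ k) s = ext (Φ (ρ k)) (ρ ∘ s) + dHom (prismOp ρ Φ) k s := by
  -- The homotopy formula is the cocycle condition evaluated on every simplex of the prism and
  -- summed.
  have h0 : ∑ j ∈ Finset.range (n + 2), dHom Φ k (prism ρ j k s) = 0 :=
    Finset.sum_eq_zero fun j _ => h _ _
  simp only [dHom] at h0 ⊢
  -- The prism `j = 0` is split off, because its face opposite the first vertex is the image of `s`
  -- under `ρ`. For the other prisms this face is a prism over `shift 1 s` with first vertex `k * s
  -- 0`.
  rw [Finset.sum_add_distrib, sum_contract_prism, Finset.sum_range_succ' _ (n + 1),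
    shift_prism_zero, mul_prism_zero] at h0
  simp only [shift_prism_succ, prism_succ_zero] at h0
  simp only [ext_prismOp]
  rw [Finset.sum_comm (s := Finset.range (n + 1)) (t := Finset.range (n + 1))] at h0
  linear_combination h0 - add_self_zmod (ext (Φ (ρ k)) (ρ ∘ s)) -
    add_self_zmod (∑ j ∈ Finset.range (n + 1), ext (Φ (k * s 0)) (prism ρ j (k * s 0) (shift 1 s))) -
    add_self_zmod (∑ j ∈ Finset.range (n + 1), ∑ i ∈ Finset.range (n + 1),
      ext (Φ k) (prism ρ i k (contract j s)))

/-- In degree zero the prism is the single edge from `k` to `ρ k`, and a cocycle takes the same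
value at both ends. -/
theorem prism_homotopy_zero (Φ : K → Cochain K 0) (h : ∀ k s, dHom Φ k s = 0) :
    ext (Φ k) s = ext (Φ (ρ k)) (ρ ∘ s) := by
  have h0 := h k (prism ρ 0 k s)
  simp only [dHom, mul_prism_zero] at h0
  have e : ∀ (f : Cochain K 0) s s', ext f s = ext f s' := fun f s s' =>
    ext_congr f fun i hi => absurd hi (by omega)
  simp only [zero_add, Finset.sum_range_one] at h0
  rw [e _ s (contract 0 (prism ρ 0 k s)), e _ (ρ ∘ s) (shift 1 (prism ρ 0 k s))]
  linear_combination h0 - add_self_zmod (ext (Φ (ρ k)) (shift 1 (prism ρ 0 k s)))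

end Prism

/-! ### Degree one classes of homomorphisms and their centrality -/

section HomClass

variable {K : Type} [Group K]

theorem d_d {n : ℕ} (f : Cochain K n) : d (d f) = 0 :=
  ConcreteCategory.congr_hom (groupCohomology.inhomogeneousCochains.d_comp_d (A := trivialRep K) n) f

theorem d_hom {χ : K → ZMod 2} (hχ : ∀ a b, χ (a * b) = χ a + χ b) :
    d (fun s => χ (s 0) : Cochain K 1) = 0 := by
  refine ext_inj fun s => ?_
  rw [ext_d, Finset.sum_range_succ, Finset.sum_range_one]
  simp only [ext, shift, contract]
  simp only [Fin.val_zero, add_zero, lt_irrefl, if_false, if_true, hχ, Nat.lt_one_iff,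
    Pi.zero_apply, zero_add]
  linear_combination add_self_zmod (χ (s 1)) + add_self_zmod (χ (s 0))

/-- The degree one class of a homomorphism to `𝔽₂`. -/
def homClass (χ : K → ZMod 2) (hχ : ∀ a b, χ (a * b) = χ a + χ b) : H K 1 :=
  cls (fun s => χ (s 0)) (d_hom hχ)

theorem of_cls_eq {m n k : ℕ} (hm : m = k + 1) (hn : n = k + 1) {f : Cochain K m}
    {g : Cochain K n} (hf : d f = 0) (hg : d g = 0) (e : Cochain K k)
    (he : ∀ s, ext (d e) s = ext f s + ext g s) :
    DirectSum.of (H K) m (cls f hf) = DirectSum.of (H K) n (cls g hg) := by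
  subst hm hn
  congr 1
  rw [cls_eq_iff]
  exact ⟨e, ext_inj he⟩

theorem exists_of_isCoboundary {m n : ℕ} (h : m + 1 = n) {f : Cochain K n}
    (hf : IsCoboundary f) : ∃ e : Cochain K m, ∀ s, ext (d e) s = ext f s := by
  subst h
  obtain ⟨e, rfl⟩ := hf
  exact ⟨e, fun _ => rfl⟩

variable {χ : K → ZMod 2} (hχ : ∀ a b, χ (a * b) = χ a + χ b)

theorem of_homClass_mul {n : ℕ} {f : Cochain K n} (hf : d f = 0) :
    DirectSum.of (H K) 1 (homClass χ hχ) * DirectSum.of (H K) n (cls f hf) =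
      DirectSum.of (H K) (1 + n) (cls (cup (fun s => χ (s 0)) f) (d_cup (d_hom hχ) hf)) := by
  rw [DirectSum.of_mul_of]
  exact congrArg _ (mul_cls _ _)

theorem mul_of_homClass {n : ℕ} {f : Cochain K n} (hf : d f = 0) :
    DirectSum.of (H K) n (cls f hf) * DirectSum.of (H K) 1 (homClass χ hχ) =
      DirectSum.of (H K) (n + 1) (cls (cup f (fun s => χ (s 0))) (d_cup hf (d_hom hχ))) := by
  rw [DirectSum.of_mul_of]
  exact congrArg _ (mul_cls _ _)

include hχ in
-- An explicit homotopy between `χ ∪ f` and `f ∪ χ`. Contracting an inner pair preserves the total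
-- product, so the formula is `χ` of the product of `n + 1` terms times the cocycle identity of `f`,
-- corrected at the two outer faces, where one term is dropped.
theorem ext_d_prefixProd_mul {n : ℕ} (f : Cochain K n) (hf : d f = 0) (s : ℕ → K) :
    ext (d (fun s => χ (prefixProd (fun i => if h : i < n then s ⟨i, h⟩ else 1) n) * f s)) s =
      χ (s 0) * ext f (shift 1 s) + ext f s * χ (s n) := by
  set e : Cochain K n :=
    fun s => χ (prefixProd (fun i => if h : i < n then s ⟨i, h⟩ else 1) n) * f s with he
  have hext : ∀ s, ext e s = χ (prefixProd s n) * ext f s := fun s => by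
    simp only [ext, he]
    congr 2
    exact prefixProd_congr fun i hi => dif_pos hi
  have h0 : ext (d f) s = 0 := by rw [hf]; rfl
  rw [ext_d, Finset.sum_range_succ, ext_contract_add f s le_rfl] at h0
  rw [ext_d, Finset.sum_range_succ, hext, hext, ext_contract_add f s le_rfl,
    prefixProd_contract_of_le s le_rfl]
  have h1 : ∀ j ∈ Finset.range n, ext e (contract j s) =
      χ (prefixProd s (n + 1)) * ext f (contract j s) := fun j hj => by
    rw [hext, prefixProd_contract_of_lt s (Finset.mem_range.1 hj)]
  rw [Finset.sum_congr rfl h1, ← Finset.mul_sum]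
  have h2 : χ (prefixProd s (n + 1)) = χ (s 0) + χ (prefixProd (shift 1 s) n) := by
    rw [prefixProd_succ', hχ]
  have h3 : χ (prefixProd s (n + 1)) = χ (prefixProd s n) + χ (s n) := by
    rw [prefixProd, hχ]
  linear_combination χ (prefixProd s (n + 1)) * h0 - ext f (shift 1 s) * h2 - ext f s * h3 -
    add_self_zmod (χ (s 0) * ext f (shift 1 s)) - add_self_zmod (ext f s * χ (s n))

theorem homClass_commute (z : HStar K) :
    Commute (DirectSum.of (H K) 1 (homClass χ hχ)) z := by
  induction z using DirectSum.induction_on with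
  | zero => exact Commute.zero_right _
  | add a b ha hb => exact ha.add_right hb
  | of n y =>
    obtain ⟨f, hf, rfl⟩ := cls_surj y
    change _ * _ = _ * _
    rw [of_homClass_mul, mul_of_homClass]
    refine of_cls_eq (add_comm 1 n) rfl _ _
      (fun s => χ (prefixProd (fun i => if h : i < n then s ⟨i, h⟩ else 1) n) * f s) fun s => ?_
    rw [ext_d_prefixProd_mul hχ f hf s, ext_cup, ext_cup]
    simp [ext, shift]

end HomClass

/-- A group `K` that contains `G` as a retract, such that `K` is the product of `G` and the group
with two elements, and `χ` is the projection to the second factor. -/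
structure IsSplit {G K : Type} [Group G] [Group K] (i : G →* K) (pr : K →* G) (χ : K → ZMod 2) :
    Prop where
  pr_i : ∀ g, pr (i g) = g
  map_mul : ∀ a b, χ (a * b) = χ a + χ b
  map_i : ∀ g, χ (i g) = 0
  exists_one : ∃ t, χ t = 1
  inv_mul : ∀ k k', χ k = χ k' → k⁻¹ * i (pr k) = k'⁻¹ * i (pr k')

/-! ### The mapping cone of multiplication by the class of a factor of order two -/

namespace IsSplit

variable {G K : Type} [Group G] [Group K] {i : G →* K} {pr : K →* G} {χ : K → ZMod 2}

theorem map_one (h : IsSplit i pr χ) : χ 1 = 0 := by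
  have := h.map_mul 1 1
  simpa using this

/-- The first vertex enters only through the entry `(k p)⁻¹ ρ(k p)`, which depends only on `χ (k
p)`. This is why the prism operator maps cones to cones. -/
theorem prism_congr (h : IsSplit i pr χ) {k k' : K} (hk : χ k = χ k') (j : ℕ) (s : ℕ → K) :
    prism (i.comp pr) j k s = prism (i.comp pr) j k' s := by
  funext m
  simp only [prism, MonoidHom.comp_apply]
  rw [h.inv_mul (k * prefixProd s j) (k' * prefixProd s j) (by rw [h.map_mul, h.map_mul, hk])]

/-- The family of cochains of the mapping cone of the product with `χ`. -/
def cone {n : ℕ} (χ : K → ZMod 2) (f g : Cochain K n) (k : K) : Cochain K n := f + χ k • g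

theorem ext_cone {K : Type} {χ : K → ZMod 2} {n : ℕ} (f g : Cochain K n) (k : K) (s : ℕ → K) :
    ext (cone χ f g k) s = ext f s + χ k * ext g s := rfl

/-- The differential of the cone is `(f, g) ↦ (d f + χ ∪ g, d g)`. The term `χ ∪ g` arises because
dropping the first vertex moves it from `k` to `k * s 0`. -/
theorem dHom_cone (h : IsSplit i pr χ) {n : ℕ} (f g : Cochain K n) (k : K) (s : ℕ → K) :
    dHom (cone χ f g) k s =
      ext (d f) s + χ (s 0) * ext g (shift 1 s) + χ k * ext (d g) s := by
  simp only [dHom, ext_cone, ext_d, Finset.sum_add_distrib, ← Finset.mul_sum, h.map_mul]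
  ring

/-- A form of Shapiro's lemma for the kernel of `χ`: a cocycle `(f, g)` of the cone is homotopic to
its pullback along `i ∘ pr`, where `χ` vanishes and only `f` survives. If that pullback is zero,
then `(f, g)` is the coboundary of `(a, b)`. -/
theorem cone_exact (h : IsSplit i pr χ) {n : ℕ} {f g : Cochain K (n + 1)} (hg : d g = 0)
    (hf : ∀ s, ext (d f) s = χ (s 0) * ext g (shift 1 s))
    (hi : ∀ s, ext f (i.comp pr ∘ s) = 0) :
    ∃ a b : Cochain K n, d b = g ∧ ∀ s, ext f s = ext (d a) s + χ (s 0) * ext b (shift 1 s) := by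
  obtain ⟨t, ht⟩ := h.exists_one
  set Φ := cone χ f g with hΦ
  set ρ := i.comp pr with hρ
  -- As `χ` takes two values and the prism operator depends on `k` only through `χ k`, it is affine
  -- in `χ k`; the values at `1` and `t` determine it.
  have hcone : prismOp ρ Φ = cone χ (prismOp ρ Φ 1) (prismOp ρ Φ t + prismOp ρ Φ 1) := by
    funext k
    have key : ∀ k', χ k = χ k' → prismOp ρ Φ k = prismOp ρ Φ k' := fun k' hk => by
      funext s
      simp only [prismOp, h.prism_congr hk, hρ, hΦ, ext_cone, hk]
    have h01 : ∀ c : ZMod 2, c = 0 ∨ c = 1 := by decide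
    rcases h01 (χ k) with hk | hk
    · rw [key 1 (hk.trans h.map_one.symm), cone, hk, zero_smul, add_zero]
    · rw [key t (hk.trans ht.symm), cone, hk, one_smul]
      funext s
      simp only [Pi.add_apply]
      linear_combination -add_self_zmod (prismOp ρ Φ 1 s)
  have hd : ∀ k s, dHom Φ k s = 0 := fun k s => by
    rw [hΦ, h.dHom_cone, hf, hg]
    change _ + _ * 0 = 0
    rw [mul_zero, add_zero, add_self_zmod]
  have main : ∀ k s, ext f s + χ k * ext g s =
      ext (d (prismOp ρ Φ 1)) s + χ (s 0) * ext (prismOp ρ Φ t + prismOp ρ Φ 1) (shift 1 s) +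
        χ k * ext (d (prismOp ρ Φ t + prismOp ρ Φ 1)) s := fun k s => by
    have h1 := prism_homotopy ρ k s Φ hd
    rw [hcone, h.dHom_cone, hΦ, ext_cone, ext_cone, hi, hρ, MonoidHom.comp_apply, h.map_i] at h1
    rw [h1, hΦ]
    ring
  -- The identity `main` at `k = 1` gives the formula for `f`; its difference with the identity at
  -- `k = t` gives `d b = g`.
  refine ⟨prismOp ρ Φ 1, prismOp ρ Φ t + prismOp ρ Φ 1, ext_inj fun s => ?_, fun s => ?_⟩
  · have h1 := main 1 s
    have h2 := main t s
    rw [h.map_one] at h1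
    rw [ht] at h2
    linear_combination h1 - h2
  · have h1 := main 1 s
    rw [h.map_one] at h1
    linear_combination h1

theorem cone_exact_zero (h : IsSplit i pr χ) {f g : Cochain K 0} (hg : d g = 0)
    (hf : ∀ s, ext (d f) s = χ (s 0) * ext g (shift 1 s))
    (hi : ∀ s, ext f (i.comp pr ∘ s) = 0) : f = 0 ∧ g = 0 := by
  obtain ⟨t, ht⟩ := h.exists_one
  have hd : ∀ k s, dHom (cone χ f g) k s = 0 := fun k s => by
    rw [h.dHom_cone, hf, hg]
    change _ + _ * 0 = 0
    rw [mul_zero, add_zero, add_self_zmod]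
  have main : ∀ k s, ext f s + χ k * ext g s = 0 := fun k s => by
    have h1 := prism_homotopy_zero (i.comp pr) k s _ hd
    rwa [ext_cone, ext_cone, hi, MonoidHom.comp_apply, h.map_i, zero_mul, add_zero] at h1
  have hf0 : f = 0 := ext_inj fun s => by
    have h1 := main 1 s
    rw [h.map_one] at h1
    change _ = 0
    linear_combination h1
  refine ⟨hf0, ext_inj fun s => ?_⟩
  have h1 := main t s
  rw [ht, hf0] at h1
  change 0 + _ = _ at h1
  change _ = 0
  linear_combination h1

/-- The class of `χ`. -/
def x (h : IsSplit i pr χ) : HStar K := DirectSum.of (H K) 1 (homClass χ h.map_mul)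

theorem d_comp_ext (φ : K →* G) {n : ℕ} (f : Cochain G n) (s : ℕ → K) :
    ext (d (fun s => f (φ ∘ s) : Cochain K n)) s = ext (d f) (φ ∘ s) := by
  rw [ext_d, ext_d]
  refine congrArg₂ _ rfl (Finset.sum_congr rfl fun j _ => congrArg f ?_)
  funext i
  simp only [Function.comp, contract]
  split_ifs <;> simp

/-- Exactness of the cone with `g = 0`: once the pullback under `pr` of a bounding cochain is used
to make `f` vanish on the image of `i ∘ pr`, `f` becomes `d a + χ ∪ b` with `d b = 0`. -/
theorem exists_eq_x_mul (h : IsSplit i pr χ) {n : ℕ} (c : H K (n + 1))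
    (hc : mapDeg i (n + 1) c = 0) :
    ∃ y : H K n, DirectSum.of (H K) (n + 1) c = h.x * DirectSum.of (H K) n y := by
  obtain ⟨f, hf, rfl⟩ := cls_surj c
  rw [mapDeg_cls, cls_eq_zero_iff] at hc
  obtain ⟨e, he⟩ := hc
  have hf' : d (f + d (fun s => e (pr ∘ s))) = 0 := by
    refine ext_inj fun s => ?_
    rw [d_add, hf, zero_add, d_d]
  obtain ⟨a, b, hb, hab⟩ := h.cone_exact (f := f + d (fun s => e (pr ∘ s))) (g := 0) d_zero
    (fun s => by rw [hf']; simp [ext]) (fun s => by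
      change ext f _ + ext (d _) _ = 0
      rw [d_comp_ext, he]
      have hs : ∀ m, i (pr (i (pr (s m)))) = i (pr (s m)) := fun m => by rw [h.pr_i]
      have : ext f (i.comp pr ∘ s) =
        ext (fun s => f (i ∘ s) : Cochain G (n + 1)) (pr ∘ i.comp pr ∘ s) := by
        refine congrArg f ?_
        funext m
        exact (hs m).symm
      rw [this, add_self_zmod])
  refine ⟨cls b hb, ?_⟩
  rw [x, of_homClass_mul]
  refine of_cls_eq rfl (add_comm 1 n) _ _ (a + fun s => e (pr ∘ s)) fun s => ?_
  have h1 := hab s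
  change ext f s + ext (d fun s => e (pr ∘ s)) s = _ at h1
  rw [d_add, ext_cup]
  change ext (d a) s + ext (d fun s => e (pr ∘ s)) s = ext f s + χ (s 0) * _
  linear_combination -h1 + add_self_zmod (ext (d fun s => e (pr ∘ s)) s) -
    add_self_zmod (χ (s 0) * ext b (shift 1 s))

theorem eq_zero_of_mapDeg_zero (i : G →* K) (c : H K 0) (hc : mapDeg i 0 c = 0) :
    c = 0 := by
  obtain ⟨f, hf, rfl⟩ := cls_surj c
  rw [mapDeg_cls, cls_eq_zero_iff] at hc
  rw [cls_eq_zero_iff]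
  refine ext_inj fun s => ?_
  have := congrFun hc (fun m => 1)
  change f _ = 0
  rw [← show f (i ∘ fun m => 1) = 0 from this]
  exact congrArg f (Subsingleton.elim _ _)

/-- A cochain `e` with `d e = χ ∪ g` makes `(e, g)` a cocycle of the cone, and exactness bounds `g`.
-/
theorem eq_zero_of_x_mul (h : IsSplit i pr χ) {n : ℕ} (y : H K n)
    (hy : h.x * DirectSum.of (H K) n y = 0) : y = 0 := by
  obtain ⟨g, hg, rfl⟩ := cls_surj y
  rw [x, of_homClass_mul] at hy
  have hy' := DirectSum.of_injective _ (hy.trans (map_zero _).symm)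
  rw [cls_eq_zero_iff] at hy'
  obtain ⟨e, he⟩ := exists_of_isCoboundary (add_comm n 1) hy'
  rw [cls_eq_zero_iff]
  have he' : ∀ s, ext (d e) s = χ (s 0) * ext g (shift 1 s) := fun s => by
    rw [he, ext_cup]; rfl
  -- Adding the pullback of `e` along `i ∘ pr` leaves the differential unchanged, since `χ ∘ i = 0`,
  -- and makes the sum vanish on the image of `i ∘ pr`.
  have hf : ∀ s, ext (d (e + fun s => e (i.comp pr ∘ s))) s = χ (s 0) * ext g (shift 1 s) :=
    fun s => by
      rw [d_add]
      change ext (d e) s + ext (d _) s = _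
      rw [d_comp_ext, he', he', Function.comp_apply, MonoidHom.comp_apply, h.map_i]
      ring
  have hi : ∀ s, ext (e + fun s => e (i.comp pr ∘ s)) (i.comp pr ∘ s) = 0 := fun s => by
    change ext e (i.comp pr ∘ s) + ext e (i.comp pr ∘ i.comp pr ∘ s) = 0
    have : i.comp pr ∘ i.comp pr ∘ s = i.comp pr ∘ s := by
      funext m
      simp [h.pr_i]
    rw [this, add_self_zmod]
  cases n with
  | zero => exact (h.cone_exact_zero hg hf hi).2
  | succ n =>
    obtain ⟨a, b, hb, -⟩ := h.cone_exact hg hf hi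
    exact ⟨b, hb⟩

end IsSplit

/-! ### Functoriality and components of products -/

section Functoriality

variable {G K L : Type} [Group G] [Group K] [Group L]

theorem map_map (φ : K →* G) (ψ : L →* K) (z : HStar G) :
    map ψ (map φ z) = map (φ.comp ψ) z := by
  induction z using DirectSum.induction_on with
  | zero => simp
  | add a b ha hb => simp [ha, hb]
  | of n y =>
    obtain ⟨f, hf, rfl⟩ := cls_surj y
    rw [map_of, map_of, map_of, mapDeg_cls, mapDeg_cls, mapDeg_cls]
    rfl

theorem map_id (z : HStar G) : map (MonoidHom.id G) z = z := by
  induction z using DirectSum.induction_on with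
  | zero => simp
  | add a b ha hb => simp [ha, hb]
  | of n y =>
    obtain ⟨f, hf, rfl⟩ := cls_surj y
    rw [map_of, mapDeg_cls]
    rfl

theorem map_of_homClass (φ : K →* G) {χ : G → ZMod 2} (hχ : ∀ a b, χ (a * b) = χ a + χ b) :
    map φ (DirectSum.of (H G) 1 (homClass χ hχ)) =
      DirectSum.of (H K) 1 (homClass (fun k => χ (φ k)) fun a b => by simp [hχ]) := by
  rw [map_of, homClass, mapDeg_cls]
  rfl

theorem map_apply (φ : K →* G) (z : HStar G) (n : ℕ) : map φ z n = mapDeg φ n (z n) := by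
  classical
  induction z using DirectSum.induction_on with
  | zero => simp
  | add a b ha hb => simp [ha, hb]
  | of m y =>
    rw [map_of]
    by_cases h : m = n
    · subst h; simp
    · rw [DirectSum.of_eq_of_ne _ _ _ (Ne.symm h), DirectSum.of_eq_of_ne _ _ _ (Ne.symm h), _root_.map_zero]

theorem of_mul_apply {p : ℕ} (a : H G p) (z : HStar G) (n : ℕ) :
    (DirectSum.of (H G) p a * z) (p + n) = mul a (z n) := by
  classical
  induction z using DirectSum.induction_on with
  | zero =>
    rw [mul_zero]
    exact (DirectSum.GNonUnitalNonAssocSemiring.mul_zero a).symm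
  | add x y hx hy =>
    rw [mul_add, DirectSum.add_apply, hx, hy]
    exact (DirectSum.GNonUnitalNonAssocSemiring.mul_add a _ _).symm
  | of m y =>
    rw [DirectSum.of_mul_of]
    by_cases h : m = n
    · subst h
      rw [DirectSum.of_eq_same, DirectSum.of_eq_same]; rfl
    · rw [DirectSum.of_eq_of_ne _ _ _ (by omega), DirectSum.of_eq_of_ne _ _ _ (Ne.symm h)]
      exact (DirectSum.GNonUnitalNonAssocSemiring.mul_zero a).symm

end Functoriality

/-! ### The cohomology of the product as polynomials in one class -/

namespace IsSplit

variable {G K : Type} [Group G] [Group K] {i : G →* K} {pr : K →* G} {χ : K → ZMod 2}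

theorem x_mul_eq_zero (h : IsSplit i pr χ) {z : HStar K} (hz : h.x * z = 0) : z = 0 := by
  refine DFinsupp.ext fun n => h.eq_zero_of_x_mul _ ?_
  have h1 : mul (homClass χ h.map_mul) (z n) = 0 := by
    rw [← of_mul_apply]
    change (h.x * z) (1 + n) = 0
    rw [hz]; rfl
  rw [x, DirectSum.of_mul_of]
  change DirectSum.of (H K) (1 + n) (mul _ (z n)) = 0
  rw [h1, _root_.map_zero]

theorem map_i_map_pr (h : IsSplit i pr χ) (z : HStar G) : map i (map pr z) = z := by
  rw [map_map, show pr.comp i = MonoidHom.id G from MonoidHom.ext h.pr_i, map_id]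

theorem map_i_x (h : IsSplit i pr χ) : map i h.x = 0 := by
  rw [x, map_of_homClass]
  have : homClass (fun k => χ (i k)) (fun a b => by simp [h.map_mul]) = (0 : H G 1) := by
    rw [homClass, cls_eq_zero_iff]
    have : (fun s => χ (i (s 0)) : Cochain G 1) = 0 := funext fun s => h.map_i _
    rw [this]
    exact isCoboundary_zero
  rw [this, _root_.map_zero]

/-- Polynomials in the class of `χ` with coefficients in the cohomology of `G`. -/
def polyMap (h : IsSplit i pr χ) : (ℕ →₀ HStar G) →ₗ[ZMod 2] HStar K :=
  Finsupp.lsum (ZMod 2) fun j =>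
    (LinearMap.mulLeft (ZMod 2) (h.x ^ j)).comp (map pr).toLinearMap

theorem polyMap_single (h : IsSplit i pr χ) (j : ℕ) (m : HStar G) :
    h.polyMap (Finsupp.single j m) = h.x ^ j * map pr m := by
  simp [polyMap]

/-- Restriction along `i` kills `x` and reads off the constant coefficient; the remaining polynomial
is divisible by the nonzerodivisor `x`. -/
theorem polyMap_injective (h : IsSplit i pr χ) : Function.Injective h.polyMap := by
  have key : ∀ (N : ℕ) (c : ℕ → HStar G),
      ∑ j ∈ Finset.range N, h.x ^ j * map pr (c j) = 0 → ∀ j < N, c j = 0 := by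
    intro N
    induction N with
    | zero => intro c _ j hj; omega
    | succ N ih =>
      intro c hc
      rw [Finset.sum_range_succ', pow_zero, one_mul] at hc
      have h1 : ∀ j ∈ Finset.range N, h.x ^ (j + 1) * map pr (c (j + 1)) =
          h.x * (h.x ^ j * map pr (c (j + 1))) := fun j _ => by
        rw [pow_succ', mul_assoc]
      rw [Finset.sum_congr rfl h1, ← Finset.mul_sum] at hc
      have h0 : c 0 = 0 := by
        have h2 := congrArg (map i) hc
        rwa [map_add, _root_.map_mul, h.map_i_x, zero_mul, zero_add, h.map_i_map_pr,
          _root_.map_zero] at h2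
      rw [h0, _root_.map_zero, add_zero] at hc
      have h3 := ih (fun j => c (j + 1)) (h.x_mul_eq_zero hc)
      intro j hj
      cases j with
      | zero => exact h0
      | succ j => exact h3 j (by omega)
  rw [injective_iff_map_eq_zero]
  intro c hc
  obtain ⟨N, hN⟩ := c.support.exists_nat_subset_range
  have hsum : h.polyMap c = ∑ j ∈ Finset.range N, h.x ^ j * map pr (c j) := by
    rw [polyMap, Finsupp.lsum_apply, Finsupp.sum_of_support_subset _ hN _ (by simp)]
    rfl
  rw [hsum] at hc
  ext1 j
  by_cases hj : j < N
  · exact key N c hc j hj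
  · exact Finsupp.notMem_support_iff.1 fun hj' => hj (Finset.mem_range.1 (hN hj'))

/-- Induction on the degree: `y - pr^* i^* y` restricts to zero, so it is `x` times a class of lower
degree, or zero in degree zero. -/
theorem polyMap_surjective (h : IsSplit i pr χ) : Function.Surjective h.polyMap := by
  have hx : ∀ z ∈ LinearMap.range h.polyMap, h.x * z ∈ LinearMap.range h.polyMap := by
    rintro _ ⟨c, rfl⟩
    induction c using Finsupp.induction_linear with
    | zero => simp
    | add a b ha hb => rw [map_add, mul_add]; exact add_mem ha hb
    | single j m =>
      refine ⟨Finsupp.single (j + 1) m, ?_⟩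
      rw [polyMap_single, polyMap_single, pow_succ', mul_assoc]
  have hpr : ∀ m, map pr m ∈ LinearMap.range h.polyMap := fun m =>
    ⟨Finsupp.single 0 m, by rw [polyMap_single, pow_zero, one_mul]⟩
  have hof : ∀ n (y : H K n), DirectSum.of (H K) n y ∈ LinearMap.range h.polyMap := by
    intro n
    induction n with
    | zero =>
      intro y
      have h0 : y - mapDeg pr 0 (mapDeg i 0 y) = 0 := eq_zero_of_mapDeg_zero i _ (by
        have h1 := h.map_i_map_pr (DirectSum.of (H G) 0 (mapDeg i 0 y))
        rw [map_of, map_of] at h1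
        rw [map_sub, DirectSum.of_injective _ h1, sub_self])
      rw [sub_eq_zero.1 h0, ← map_of]
      exact hpr _
    | succ n ih =>
      intro y
      obtain ⟨w, hw⟩ := h.exists_eq_x_mul (y - mapDeg pr (n + 1) (mapDeg i (n + 1) y)) (by
        have h1 := h.map_i_map_pr (DirectSum.of (H G) (n + 1) (mapDeg i (n + 1) y))
        rw [map_of, map_of] at h1
        rw [map_sub, DirectSum.of_injective _ h1, sub_self])
      rw [map_sub, sub_eq_iff_eq_add, ← map_of] at hw
      rw [hw]
      exact add_mem (hx _ (ih w)) (hpr _)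
  intro z
  change z ∈ LinearMap.range h.polyMap
  induction z using DirectSum.induction_on with
  | zero => exact zero_mem _
  | add a b ha hb => exact add_mem ha hb
  | of n y => exact hof n y

/-- If `b` is a basis of the cohomology of `G`, then its products with the powers of the class of
`χ` form a basis of the cohomology of `K`. -/
def basis (h : IsSplit i pr χ) {κ : Type} (b : Module.Basis κ (ZMod 2) (HStar G)) :
    Module.Basis (Σ _ : ℕ, κ) (ZMod 2) (HStar K) :=
  (Finsupp.basis fun _ : ℕ => b).map
    (LinearEquiv.ofBijective h.polyMap ⟨h.polyMap_injective, h.polyMap_surjective⟩)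

theorem basis_apply (h : IsSplit i pr χ) {κ : Type} (b : Module.Basis κ (ZMod 2) (HStar G))
    (j : ℕ) (k : κ) : h.basis b ⟨j, k⟩ = h.x ^ j * map pr (b k) := by
  rw [basis, Module.Basis.map_apply, Finsupp.coe_basis]
  exact h.polyMap_single j (b k)

end IsSplit

/-- The group with two elements. -/
abbrev C2 : Type := Multiplicative (ZMod 2)

/-! ### Evaluation of polynomials at central degree one classes -/

section Eval

variable {σ : Type} {K L : Type} [Group K] [Group L]

/-- The class of a homomorphism to the group with two elements, as an element of the center of the
cohomology ring. -/
def centralClass (χ : K →* C2) : Subalgebra.center (ZMod 2) (HStar K) :=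
  ⟨DirectSum.of (H K) 1 (homClass (fun k => (χ k).toAdd) fun a b => by simp),
    Subalgebra.mem_center_iff.2 fun z => (homClass_commute _ z).symm⟩

/-- The evaluation of polynomials at the classes of homomorphisms to the group with two
elements. -/
def ev (χ : σ → K →* C2) : MvPolynomial σ (ZMod 2) →ₐ[ZMod 2] HStar K :=
  (Subalgebra.center (ZMod 2) (HStar K)).val.comp (MvPolynomial.aeval fun j => centralClass (χ j))

theorem ev_X (χ : σ → K →* C2) (j : σ) :
    ev χ (MvPolynomial.X j) =
      DirectSum.of (H K) 1 (homClass (fun k => (χ j k).toAdd) fun a b => by simp) := by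
  rw [ev, AlgHom.comp_apply, MvPolynomial.aeval_X]
  rfl

theorem ev_commute (χ : σ → K →* C2) (p : MvPolynomial σ (ZMod 2)) (z : HStar K) :
    Commute (ev χ p) z :=
  (Subalgebra.mem_center_iff.1 (MvPolynomial.aeval (fun j => centralClass (χ j)) p).2 z).symm

theorem map_ev (χ : σ → K →* C2) (φ : L →* K) (p : MvPolynomial σ (ZMod 2)) :
    map φ (ev χ p) = ev (fun j => (χ j).comp φ) p := by
  have : (map φ).comp (ev χ) = ev fun j => (χ j).comp φ := by
    refine MvPolynomial.algHom_ext fun j => ?_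
    rw [AlgHom.comp_apply, ev_X, ev_X, map_of_homClass]
    rfl
  exact DFunLike.congr_fun this p

theorem ev_rename {τ : Type} (χ : σ → K →* C2) (f : τ → σ) (p : MvPolynomial τ (ZMod 2)) :
    ev χ (MvPolynomial.rename f p) = ev (fun j => χ (f j)) p := by
  have : (ev χ).comp (MvPolynomial.rename f) = ev fun j => χ (f j) := by
    refine MvPolynomial.algHom_ext fun j => ?_
    rw [AlgHom.comp_apply, MvPolynomial.rename_X, ev_X, ev_X]
  exact DFunLike.congr_fun this p

end Eval

/-! ### Künneth formula for an elementary abelian factor -/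

section Power

variable (n : ℕ) (G : Type) [Group G]

/-- The `j`-th coordinate of the elementary abelian factor. -/
def coord (j : Fin n) : (Fin n → C2) × G →* C2 :=
  (Pi.evalMonoidHom (fun _ : Fin n => C2) j).comp (MonoidHom.fst _ _)

/-- The projection that forgets the first coordinate. -/
def tailHom : (Fin (n + 1) → C2) × G →* (Fin n → C2) × G where
  toFun k := (Fin.tail k.1, k.2)
  map_one' := rfl
  map_mul' _ _ := rfl

/-- The inclusion of the elements with trivial first coordinate. -/
def consHom : (Fin n → C2) × G →* (Fin (n + 1) → C2) × G where
  toFun k := (Fin.cons 1 k.1, k.2)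
  map_one' := Prod.ext (funext fun j => by refine Fin.cases ?_ (fun j => ?_) j <;> rfl) rfl
  map_mul' _ _ := Prod.ext (funext fun j => by refine Fin.cases ?_ (fun j => ?_) j <;> rfl) rfl

theorem isSplit_cons :
    IsSplit (consHom n G) (tailHom n G) fun k => (coord (n + 1) G 0 k).toAdd where
  pr_i _ := rfl
  map_mul a b := by simp
  map_i _ := rfl
  exists_one := ⟨(fun _ => Multiplicative.ofAdd 1, 1), rfl⟩
  inv_mul k k' h := by
    have h0 : k.1 0 = k'.1 0 := h
    refine Prod.ext (funext fun j => ?_) ((inv_mul_cancel k.2).trans (inv_mul_cancel k'.2).symm)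
    refine Fin.cases ?_ (fun j => ?_) j
    · exact congrArg (fun a : C2 => a⁻¹ * 1) h0
    · exact (inv_mul_cancel (k.1 j.succ)).trans (inv_mul_cancel (k'.1 j.succ)).symm

/-- Splitting off the first exponent of a monomial. -/
def consEquiv (κ : Type) : (Σ _ : ℕ, (Fin n →₀ ℕ) × κ) ≃ (Fin (n + 1) →₀ ℕ) × κ where
  toFun a := (a.2.1.cons a.1, a.2.2)
  invFun a := ⟨a.1 0, a.1.tail, a.2⟩
  left_inv a := by simp
  right_inv a := by simp

theorem monomial_cons (j : ℕ) (α : Fin n →₀ ℕ) :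
    MvPolynomial.monomial (α.cons j) (1 : ZMod 2) = MvPolynomial.X 0 ^ j *
      MvPolynomial.rename Fin.succ (MvPolynomial.monomial α 1) := by
  rw [MvPolynomial.rename_monomial, MvPolynomial.X_pow_eq_monomial, MvPolynomial.monomial_mul,
    mul_one]
  refine congrArg (fun β => MvPolynomial.monomial β (1 : ZMod 2)) (Finsupp.ext fun m => ?_)
  refine Fin.cases ?_ (fun m => ?_) m
  · rw [Finsupp.cons_zero, Finsupp.add_apply, Finsupp.single_eq_same,
      Finsupp.mapDomain_of_notMem_range _ _ (by simp), add_zero]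
  · rw [Finsupp.cons_succ, Finsupp.add_apply, Finsupp.single_eq_of_ne (Fin.succ_ne_zero m),
      Finsupp.mapDomain_apply (Fin.succ_injective n), zero_add]

theorem exists_basis_power {κ : Type} (b : Module.Basis κ (ZMod 2) (HStar G)) :
    ∃ B : Module.Basis ((Fin n →₀ ℕ) × κ) (ZMod 2) (HStar ((Fin n → C2) × G)),
      ∀ α k, B (α, k) = ev (coord n G) (MvPolynomial.monomial α 1) *
        map (MonoidHom.snd _ _) (b k) := by
  induction n with
  | zero =>
    have hi : ∀ z : HStar ((Fin 0 → C2) × G),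
        map (MonoidHom.snd _ _) (map (MonoidHom.inr (Fin 0 → C2) G) z) = z := fun z => by
      rw [map_map, show (MonoidHom.inr (Fin 0 → C2) G).comp (MonoidHom.snd _ _) =
        MonoidHom.id _ from MonoidHom.ext fun a => Prod.ext (Subsingleton.elim _ _) rfl, map_id]
    have hi' : ∀ z : HStar G,
        map (MonoidHom.inr (Fin 0 → C2) G) (map (MonoidHom.snd _ _) z) = z := fun z => by
      rw [map_map, show (MonoidHom.snd _ _).comp (MonoidHom.inr (Fin 0 → C2) G) =
        MonoidHom.id _ from MonoidHom.ext fun a => rfl, map_id]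
    refine ⟨(b.map (AlgEquiv.ofAlgHom (map (MonoidHom.snd (Fin 0 → C2) G))
      (map (MonoidHom.inr _ _)) (AlgHom.ext hi) (AlgHom.ext hi')).toLinearEquiv).reindex
      (Equiv.uniqueProd κ (Fin 0 →₀ ℕ)).symm, fun α k => ?_⟩
    have hα : α = 0 := Subsingleton.elim _ _
    rw [hα, show MvPolynomial.monomial (0 : Fin 0 →₀ ℕ) (1 : ZMod 2) = 1 from rfl, map_one, one_mul,
      Module.Basis.reindex_apply, Module.Basis.map_apply]
    rfl
  | succ n ih =>
    obtain ⟨B, hB⟩ := ih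
    refine ⟨((isSplit_cons n G).basis B).reindex (consEquiv n κ), fun α k => ?_⟩
    rw [Module.Basis.reindex_apply]
    change (isSplit_cons n G).basis B ⟨α 0, α.tail, k⟩ = _
    rw [IsSplit.basis_apply, hB, map_mul, map_map, map_ev, ← mul_assoc]
    congr 1
    conv_rhs => rw [← Finsupp.cons_tail α]
    rw [monomial_cons, map_mul, map_pow, ev_rename, ev_X]
    rfl

end Power

/-! ### Connectedness: cohomology in degree zero -/

section DegreeZero

variable {G : Type} [Group G]

theorem exists_eq_smul_one (y : H G 0) : ∃ r : ZMod 2, y = r • one := by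
  obtain ⟨f, hf, rfl⟩ := cls_surj y
  refine ⟨f fun _ => 1, ?_⟩
  rw [one, ← cls_smul]
  congr 1
  funext s
  rw [Subsingleton.elim s fun _ => 1]
  simp

theorem one_ne_zero : (one : H G 0) ≠ 0 := by
  rw [one, Ne, cls_eq_zero_iff]
  intro h
  exact absurd (congrFun h fun _ => 1) (by simp)

/-- The cohomology in degree zero is one-dimensional. -/
def degZeroEquiv (G : Type) [Group G] : ZMod 2 ≃ₗ[ZMod 2] H G 0 :=
  LinearEquiv.ofBijective (LinearMap.toSpanSingleton (ZMod 2) (H G 0) one)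
    ⟨by
      rw [injective_iff_map_eq_zero]
      intro r hr
      exact (smul_eq_zero.1 hr).resolve_right one_ne_zero,
    fun y => by
      obtain ⟨r, rfl⟩ := exists_eq_smul_one y
      exact ⟨r, rfl⟩⟩

theorem of_zero_eq_algebraMap (y : H G 0) :
    DirectSum.of (H G) 0 y = algebraMap (ZMod 2) (HStar G) ((degZeroEquiv G).symm y) := by
  obtain ⟨r, rfl⟩ := (degZeroEquiv G).surjective y
  rw [LinearEquiv.symm_apply_apply]
  rfl

end DegreeZero

section Components

variable {G : Type} [Group G]

theorem add_self (z : HStar G) : z + z = 0 := by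
  rw [← two_smul (ZMod 2) z, show (2 : ZMod 2) = 0 from rfl, zero_smul]

theorem sum_components (z : HStar G) : ∃ s : Finset ℕ, z = ∑ d ∈ s, DirectSum.of (H G) d (z d) := by
  classical
  exact ⟨_, (DirectSum.sum_support_of z).symm⟩

theorem of_apply_of_ne {a d : ℕ} (h : a ≠ d) (y : H G a) : DirectSum.of (H G) a y d = 0 :=
  DirectSum.of_eq_of_ne _ _ _ (Ne.symm h)

theorem sum_apply {ι : Type} (s : Finset ι) (f : ι → HStar G) (d : ℕ) :
    (∑ i ∈ s, f i) d = ∑ i ∈ s, f i d :=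
  map_sum (DirectSum.component (ZMod 2) ℕ (H G) d) f s

theorem smul_apply' (r : ZMod 2) (z : HStar G) (d : ℕ) : (r • z) d = r • z d := rfl

theorem mul_apply_eq_zero {p q : HStar G} {m m' : ℕ} (hp : ∀ d < m, p d = 0)
    (hq : ∀ d < m', q d = 0) : ∀ d < m + m', (p * q) d = 0 := by
  intro d hd
  obtain ⟨s, hs⟩ := sum_components p
  obtain ⟨t, ht⟩ := sum_components q
  rw [hs, ht, Finset.sum_mul_sum, sum_apply]
  refine Finset.sum_eq_zero fun a _ => ?_
  rw [sum_apply]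
  refine Finset.sum_eq_zero fun b _ => ?_
  by_cases ha : a < m
  · rw [hp a ha, map_zero, zero_mul]; rfl
  by_cases hb : b < m'
  · rw [hq b hb, map_zero, mul_zero]; rfl
  rw [DirectSum.of_mul_of]
  exact of_apply_of_ne (by omega) _

end Components

/-! ### Graded projective modules are free -/

section GradedNakayama

variable {G : Type} [Group G] (P : Subalgebra (ZMod 2) (HStar G))

/-- The products of the elements of positive degree of `P` with arbitrary elements. -/
def posMul : Submodule (ZMod 2) (HStar G) :=
  Submodule.span (ZMod 2) {z | ∃ a, ∃ y : H G a, ∃ b, ∃ w : H G b, 0 < a ∧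
    DirectSum.of (H G) a y ∈ P ∧ z = DirectSum.of (H G) a y * DirectSum.of (H G) b w}

/-- Stated for an arbitrary target `S`, because it serves twice: it shows that `posMul P` is graded,
and it drives the degree induction in Nakayama's lemma. -/
theorem component_mem_of_mem_posMul {S : Submodule (ZMod 2) (HStar G)} {d : ℕ}
    (h : ∀ a (y : H G a) b (w : H G b), 0 < a → DirectSum.of (H G) a y ∈ P → a + b = d →
      DirectSum.of (H G) a y * DirectSum.of (H G) b w ∈ S) {z : HStar G} (hz : z ∈ posMul P) :
    DirectSum.of (H G) d (z d) ∈ S := by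
  induction hz using Submodule.span_induction with
  | mem z hz =>
    obtain ⟨a, y, b, w, ha, hy, rfl⟩ := hz
    by_cases hd : a + b = d
    · have h1 := h a y b w ha hy hd
      subst hd
      rw [DirectSum.of_mul_of] at h1 ⊢
      rwa [DirectSum.of_eq_same]
    · rw [DirectSum.of_mul_of, of_apply_of_ne hd, map_zero]
      exact zero_mem _
  | zero => rw [DirectSum.zero_apply, map_zero]; exact zero_mem _
  | add a b _ _ ha hb => rw [DirectSum.add_apply, map_add]; exact add_mem ha hb
  | smul r a _ ha =>
    rw [smul_apply', ← DirectSum.lof_eq_of (ZMod 2), map_smul]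
    exact S.smul_mem r ha

theorem component_mem_posMul {z : HStar G} (hz : z ∈ posMul P) (d : ℕ) :
    DirectSum.of (H G) d (z d) ∈ posMul P :=
  component_mem_of_mem_posMul P (S := posMul P) (fun a y b w ha hy _ =>
    Submodule.subset_span ⟨a, y, b, w, ha, hy, rfl⟩) hz

variable {P}

theorem mul_mem_posMul (hP : IsGraded P) {p : HStar G} (hp : p ∈ P) (h0 : p 0 = 0)
    (m : HStar G) : p * m ∈ posMul P := by
  obtain ⟨s, hs⟩ := sum_components p
  obtain ⟨t, ht⟩ := sum_components m
  rw [hs, ht, Finset.sum_mul_sum]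
  refine sum_mem fun a _ => sum_mem fun b _ => ?_
  rcases Nat.eq_zero_or_pos a with rfl | ha
  · rw [h0, map_zero, zero_mul]; exact zero_mem _
  · exact Submodule.subset_span ⟨a, p a, b, m b, ha, hP p hp a, rfl⟩

/-- A graded projective module over a connected graded algebra is free. -/
theorem free_of_projective (hP : IsGraded P) [Module.Projective P (HStar G)] :
    Module.Free P (HStar G) := by
  classical
  -- Let `M` be the whole cohomology and `P₊` the positive part of `P`. `J d` is the degree `d` part
  -- of `P₊ M`, so bases of the complements `W d` lift a homogeneous basis of `M / P₊ M`.
  let J : ∀ d, Submodule (ZMod 2) (H G d) := fun d =>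
    (posMul P).comap (DirectSum.lof (ZMod 2) ℕ (H G) d)
  choose W hW using fun d => (J d).exists_isCompl
  let b := fun d => Module.Basis.ofVectorSpace (ZMod 2) (W d)
  let I := Σ d, Module.Basis.ofVectorSpaceIndex (ZMod 2) (W d)
  let v : I → HStar G := fun i => DirectSum.of (H G) i.1 (b i.1 i.2 : H G i.1)
  let E : (I →₀ P) →ₗ[P] HStar G := Finsupp.linearCombination P v
  have hsurj : Function.Surjective E := by
    let S : Submodule (ZMod 2) (HStar G) := (LinearMap.range E).restrictScalars (ZMod 2)
    have hof : ∀ d (y : H G d), DirectSum.of (H G) d y ∈ S := by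
      intro d
      induction d using Nat.strong_induction_on with
      | _ d ih =>
        intro y
        obtain ⟨u, hu, w, hw, rfl⟩ := Submodule.mem_sup.1
          ((hW d).sup_eq_top ▸ Submodule.mem_top : y ∈ J d ⊔ W d)
        rw [map_add]
        refine add_mem ?_ ?_
        -- A product with a factor of positive degree in `P` has its other factor in degree below
        -- `d`.
        · have h1 := component_mem_of_mem_posMul P (S := S) (d := d)
            (fun a y' b' w' ha hy hd => by
              have h2 : DirectSum.of (H G) b' w' ∈ LinearMap.range E := ih b' (by omega) w'
              exact (LinearMap.range E).smul_mem ⟨_, hy⟩ h2) hu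
          rwa [DirectSum.lof_eq_of, DirectSum.of_eq_same] at h1
        · have h2 : (⟨w, hw⟩ : W d) ∈ Submodule.span (ZMod 2) (Set.range (b d)) := by
            rw [(b d).span_eq]; trivial
          have h3 : Submodule.span (ZMod 2) (Set.range (b d)) ≤
              S.comap ((DirectSum.lof (ZMod 2) ℕ (H G) d).comp (W d).subtype) := by
            rw [Submodule.span_le]
            rintro _ ⟨k, rfl⟩
            exact ⟨Finsupp.single ⟨d, k⟩ 1, by
              rw [Finsupp.linearCombination_single, one_smul]; rfl⟩
          exact h3 h2
    intro z
    obtain ⟨s, hs⟩ := sum_components z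
    have : z ∈ S := by
      rw [hs]
      exact sum_mem fun d _ => hof d _
    exact this
  -- The coordinate functionals of `M / P₊ M`, dual to the family `v`.
  let lam : I → HStar G →ₗ[ZMod 2] ZMod 2 := fun i =>
    ((b i.1).coord i.2).comp ((Submodule.projectionOnto _ _ (hW i.1).symm).comp
      (DirectSum.component (ZMod 2) ℕ (H G) i.1))
  have hlamJ : ∀ i, ∀ z ∈ posMul P, lam i z = 0 := by
    intro i z hz
    have h1 : z i.1 ∈ J i.1 := component_mem_posMul P hz i.1
    change (b i.1).coord i.2 (Submodule.projectionOnto _ _ (hW i.1).symm (z i.1)) = 0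
    rw [(Submodule.projectionOnto_apply_eq_zero_iff (hW i.1).symm).2 h1, map_zero]
  have hlamv : ∀ i j, lam i (v j) = if j = i then 1 else 0 := by
    rintro ⟨d, k⟩ ⟨d', k'⟩
    change (b d).coord k (Submodule.projectionOnto _ _ (hW d).symm
      (DirectSum.of (H G) d' (b d' k' : H G d') d)) = _
    by_cases h : d' = d
    · subst h
      rw [DirectSum.of_eq_same, Submodule.projectionOnto_apply_left, Module.Basis.coord_apply,
        Module.Basis.repr_self, Finsupp.single_apply]
      refine if_congr ⟨?_, fun h => eq_of_heq (Sigma.mk.inj h).2⟩ rfl rfl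
      rintro rfl
      rfl
    · rw [of_apply_of_ne h, map_zero, map_zero, if_neg]
      rintro ⟨⟩
      exact h rfl
  -- Read modulo `P₊ M`, a relation among the `v j` involves only the degree zero components of its
  -- coefficients, and `lam` shows that these vanish.
  have hone : ∀ κ : I →₀ P, E κ = 0 → ∀ i, ∀ d < 1, (κ i : HStar G) d = 0 := by
    intro κ hκ i d hd
    obtain rfl : d = 0 := by omega
    let c : I → ZMod 2 := fun j => (degZeroEquiv G).symm ((κ j : HStar G) 0)
    have hc : ∀ j, (κ j : HStar G) * v j - c j • v j ∈ posMul P := fun j => by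
      rw [Algebra.smul_def, ← sub_mul]
      refine mul_mem_posMul hP (P.sub_mem (κ j).2 (P.algebraMap_mem _)) ?_ _
      rw [← of_zero_eq_algebraMap, DirectSum.sub_apply, DirectSum.of_eq_same, sub_self]
    have hsum : ∑ j ∈ κ.support, c j • v j ∈ posMul P := by
      have h1 : ∑ j ∈ κ.support, ((κ j : HStar G) * v j - c j • v j) ∈ posMul P :=
        sum_mem fun j _ => hc j
      rw [Finset.sum_sub_distrib] at h1
      have h2 : ∑ j ∈ κ.support, (κ j : HStar G) * v j = 0 := hκ
      rw [h2, zero_sub] at h1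
      exact neg_mem_iff.1 h1
    have h3 := hlamJ i _ hsum
    rw [map_sum] at h3
    simp only [map_smul, hlamv, smul_eq_mul, mul_ite, mul_one, mul_zero] at h3
    rw [Finset.sum_ite_eq' κ.support i] at h3
    by_cases hi : i ∈ κ.support
    · rw [if_pos hi] at h3
      exact (map_eq_zero_iff _ (degZeroEquiv G).symm.injective).1 h3
    · rw [Finsupp.notMem_support_iff.1 hi]
      rfl
  obtain ⟨s, hs⟩ := Module.projective_lifting_property E LinearMap.id hsurj
  have hs' : ∀ z, E (s z) = z := fun z => DFunLike.congr_fun hs z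
  have hall : ∀ m, ∀ κ : I →₀ P, E κ = 0 → ∀ i, ∀ d < m, (κ i : HStar G) d = 0 := by
    intro m
    induction m with
    | zero => intro _ _ _ d hd; omega
    | succ m ih =>
      intro κ hκ i
      -- Projectivity splits `E`, so `id - s E`, written with a plus sign mod 2, projects onto the
      -- relations. A relation `κ` is thus the combination, with its own coefficients, of the
      -- relations `e (single j 1)`, whose coefficients start in degree one. So vanishing below `m`
      -- improves to vanishing below `m + 1`.
      let e : (I →₀ P) →ₗ[P] (I →₀ P) := LinearMap.id + s.comp E
      have he : e κ = κ := by simp [e, hκ]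
      have hE : ∀ κ', E (e κ') = 0 := fun κ' => by simp [e, hs', add_self]
      have hκsum : κ i = ∑ j ∈ κ.support, κ j * (e (Finsupp.single j 1)) i := by
        have h1 : e κ = ∑ j ∈ κ.support, κ j • e (Finsupp.single j 1) := by
          simp only [← map_smul, ← map_sum, Finsupp.smul_single_one]
          exact congrArg e (Finsupp.sum_single κ).symm
        conv_lhs => rw [← he, h1, Finsupp.finsetSum_apply]
        rfl
      rw [hκsum]
      intro d hd
      rw [AddSubmonoidClass.coe_finsetSum, sum_apply]
      exact Finset.sum_eq_zero fun j _ =>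
        mul_apply_eq_zero (ih κ hκ j) (hone _ (hE (Finsupp.single j 1)) i) d hd
  have hinj : Function.Injective E := by
    rw [injective_iff_map_eq_zero]
    intro κ hκ
    refine Finsupp.ext fun i => Subtype.ext (DFinsupp.ext fun d => ?_)
    exact hall (d + 1) κ hκ i d (Nat.lt_succ_self d)
  exact Module.Free.of_basis (Module.Basis.ofRepr (LinearEquiv.ofBijective E ⟨hinj, hsurj⟩).symm)

end GradedNakayama

end ModTwo

/-- A linear map differing from the identity by a locally nilpotent one is bijective. -/
theorem LinearMap.bijective_one_sub_of_locally_nilpotent {F N : Type*} [Ring F] [AddCommGroup N]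
    [Module F N] (ν : Module.End F N) (h : ∀ z, ∃ t, (ν ^ t) z = 0) :
    Function.Bijective (1 - ν : Module.End F N) := by
  constructor
  · rw [injective_iff_map_eq_zero]
    intro z hz
    have h1 : ν z = z := (sub_eq_zero.1 hz).symm
    obtain ⟨t, ht⟩ := h z
    have h2 : ∀ t, (ν ^ t) z = z := fun t => by
      induction t with
      | zero => rfl
      | succ t ih => rw [pow_succ, Module.End.mul_apply, h1, ih]
    rw [← h2 t, ht]
  · intro z
    obtain ⟨t, ht⟩ := h z
    refine ⟨(∑ j ∈ Finset.range t, ν ^ j) z, ?_⟩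
    rw [← Module.End.mul_apply, mul_neg_geom_sum, LinearMap.sub_apply, ht, sub_zero]
    rfl

/-- A criterion for freeness over an algebra, by a triangular comparison with a basis over the
base field. -/
theorem Module.Free.of_triangular {F R N I Γ J : Type*} [Field F] [Ring R] [Algebra F R]
    [AddCommGroup N] [Module F N] [Module R N] [IsScalarTower F R N] (bR : Module.Basis Γ F R)
    (B : Module.Basis J F N) (e : (Σ _ : I, Γ) ≃ J) (v : I → N) (deg wt : J → ℕ)
    (hwt : ∀ j, wt j ≤ deg j)
    (h : ∀ i γ, bR γ • v i - B (e ⟨i, γ⟩) ∈ Submodule.span F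
      (B '' {j | deg j = deg (e ⟨i, γ⟩) ∧ wt (e ⟨i, γ⟩) < wt j})) :
    Module.Free R N := by
  classical
  let E₁ : (I →₀ R) ≃ₗ[F] N := (Finsupp.basis fun _ : I => bR).equiv B e
  let E₂ : (I →₀ R) →ₗ[R] N := Finsupp.linearCombination R v
  -- Under the identification `E₁` of the bases, `E₂` becomes `τ`. The triangularity hypothesis says
  -- that `ν = 1 - τ` preserves `deg` and strictly raises `wt`.
  let τ : Module.End F N := (E₂.restrictScalars F).comp E₁.symm.toLinearMap
  let ν : Module.End F N := 1 - τ
  have hτ : ∀ i γ, τ (B (e ⟨i, γ⟩)) = bR γ • v i := fun i γ => by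
    have h1 : E₁.symm (B (e ⟨i, γ⟩)) = Finsupp.single i (bR γ) := by
      rw [LinearEquiv.symm_apply_eq]
      have h2 := (Finsupp.basis fun _ : I => bR).equiv_apply ⟨i, γ⟩ B e
      rw [Finsupp.coe_basis] at h2
      exact h2.symm
    change E₂ (E₁.symm _) = _
    rw [h1]
    exact Finsupp.linearCombination_single R _ _
  have hν : ∀ j, ν (B j) ∈ Submodule.span F (B '' {j' | deg j' = deg j ∧ wt j < wt j'}) := by
    intro j
    obtain ⟨⟨i, γ⟩, rfl⟩ := e.surjective j
    have h1 : ν (B (e ⟨i, γ⟩)) = -(bR γ • v i - B (e ⟨i, γ⟩)) := by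
      rw [neg_sub, ← hτ]
      rfl
    rw [h1]
    exact neg_mem (h i γ)
  -- `t` bounds the room left for the weight: in degree `m` no weight reaches `m + 1`, and each
  -- application of `ν` uses up at least one step.
  have hpow : ∀ (t m : ℕ), ∀ z ∈ Submodule.span F (B '' {j | deg j = m ∧ m + 1 ≤ wt j + t}),
      (ν ^ t) z = 0 := by
    intro t
    induction t with
    | zero =>
      intro m z hz
      have h1 : {j | deg j = m ∧ m + 1 ≤ wt j + 0} = ∅ := by
        ext j
        simp only [Set.mem_ofPred_eq, Set.mem_empty_iff_false, iff_false]
        have := hwt j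
        omega
      rw [h1, Set.image_empty, Submodule.span_empty, Submodule.mem_bot] at hz
      exact hz
    | succ t ih =>
      intro m z hz
      have h1 : Submodule.span F (B '' {j | deg j = m ∧ m + 1 ≤ wt j + (t + 1)}) ≤
          LinearMap.ker (ν ^ (t + 1)) := by
        rw [Submodule.span_le]
        rintro _ ⟨j, ⟨hj, hj'⟩, rfl⟩
        change (ν ^ (t + 1)) (B j) = 0
        rw [pow_succ, Module.End.mul_apply]
        refine ih m _ (Submodule.span_mono (Set.image_mono ?_) (hν j))
        rintro j' ⟨h2, h3⟩
        exact ⟨h2.trans hj, by omega⟩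
      exact h1 hz
  have hnil : ∀ z, ∃ t, (ν ^ t) z = 0 := by
    intro z
    have hz : z ∈ Submodule.span F (Set.range B) := by rw [B.span_eq]; trivial
    have hmono : ∀ (w : N) {a b : ℕ}, a ≤ b → (ν ^ a) w = 0 → (ν ^ b) w = 0 := by
      intro w a b hab hw
      rw [← Nat.sub_add_cancel hab, pow_add, Module.End.mul_apply, hw, map_zero]
    induction hz using Submodule.span_induction with
    | mem z hz =>
      obtain ⟨j, rfl⟩ := hz
      exact ⟨deg j + 1, hpow _ (deg j) _ (Submodule.subset_span ⟨j, ⟨rfl, by omega⟩, rfl⟩)⟩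
    | zero => exact ⟨0, rfl⟩
    | add a b _ _ ha hb =>
      obtain ⟨t, ht⟩ := ha
      obtain ⟨t', ht'⟩ := hb
      exact ⟨max t t', by rw [map_add, hmono _ (le_max_left _ _) ht,
        hmono _ (le_max_right _ _) ht', add_zero]⟩
    | smul r a _ ha =>
      obtain ⟨t, ht⟩ := ha
      exact ⟨t, by rw [map_smul, ht, smul_zero]⟩
  have hbij : Function.Bijective τ := by
    have h1 := LinearMap.bijective_one_sub_of_locally_nilpotent ν hnil
    rwa [show (1 - ν : Module.End F N) = τ from sub_sub_cancel _ _] at h1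
  have hE : Function.Bijective E₂ := by
    have h1 : (E₂ : (I →₀ R) → N) = τ ∘ E₁ := by
      funext c
      exact congrArg E₂ (E₁.symm_apply_apply c).symm
    rw [h1]
    exact hbij.comp E₁.bijective
  exact Module.Free.of_basis (Module.Basis.ofRepr (LinearEquiv.ofBijective E₂ hE).symm)

/-- Division with remainder of exponents. -/
def Finsupp.divModEquiv (n q : ℕ) [NeZero q] :
    (Fin n → Fin q) × (Fin n →₀ ℕ) ≃ (Fin n →₀ ℕ) where
  toFun a := Finsupp.equivFunOnFinite.symm fun j => q * a.2 j + a.1 j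
  invFun α := (fun j => ⟨α j % q, Nat.mod_lt _ (NeZero.pos q)⟩,
    Finsupp.equivFunOnFinite.symm fun j => α j / q)
  left_inv a := by
    refine Prod.ext (funext fun j => Fin.ext ?_) (Finsupp.ext fun j => ?_)
    · simp [Nat.mod_eq_of_lt]
    · simp [Nat.mul_add_div (NeZero.pos q), Nat.div_eq_of_lt]
  right_inv α := Finsupp.ext fun j => by simp [Nat.div_add_mod]

namespace ModTwo

/-! ### Homogeneous elements and homogeneous bases -/

section Homogeneous

variable {G K : Type} [Group G] [Group K]

/-- The homogeneous elements of degree `m`. -/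
def homog (K : Type) [Group K] (m : ℕ) : Submodule (ZMod 2) (HStar K) :=
  LinearMap.range (DirectSum.lof (ZMod 2) ℕ (H K) m)

theorem of_mem_homog (m : ℕ) (y : H K m) : DirectSum.of (H K) m y ∈ homog K m := ⟨y, rfl⟩

theorem exists_of_mem_homog {m : ℕ} {z : HStar K} (hz : z ∈ homog K m) :
    ∃ y, z = DirectSum.of (H K) m y := by
  obtain ⟨y, rfl⟩ := hz
  exact ⟨y, rfl⟩

theorem one_mem_homog : (1 : HStar K) ∈ homog K 0 := of_mem_homog 0 one

theorem mul_mem_homog {m m' : ℕ} {z z' : HStar K} (hz : z ∈ homog K m) (hz' : z' ∈ homog K m') :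
    z * z' ∈ homog K (m + m') := by
  obtain ⟨y, rfl⟩ := exists_of_mem_homog hz
  obtain ⟨y', rfl⟩ := exists_of_mem_homog hz'
  rw [DirectSum.of_mul_of]
  exact of_mem_homog _ _

theorem pow_mem_homog {m : ℕ} {z : HStar K} (hz : z ∈ homog K m) (k : ℕ) :
    z ^ k ∈ homog K (k * m) := by
  induction k with
  | zero => rw [zero_mul, pow_zero]; exact one_mem_homog
  | succ k ih => rw [pow_succ, Nat.succ_mul]; exact mul_mem_homog ih hz

theorem map_mem_homog (φ : K →* G) {m : ℕ} {z : HStar G} (hz : z ∈ homog G m) :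
    map φ z ∈ homog K m := by
  obtain ⟨y, rfl⟩ := exists_of_mem_homog hz
  rw [map_of]
  exact of_mem_homog _ _

theorem ev_monomial_mem_homog {σ : Type} (χ : σ → K →* C2) (α : σ →₀ ℕ) :
    ev χ (MvPolynomial.monomial α 1) ∈ homog K α.degree := by
  induction α using Finsupp.induction_linear with
  | zero =>
    rw [map_zero, show MvPolynomial.monomial (0 : σ →₀ ℕ) (1 : ZMod 2) = 1 from rfl, map_one]
    exact one_mem_homog
  | add α β hα hβ =>
    rw [map_add, ← mul_one (1 : ZMod 2), ← MvPolynomial.monomial_mul, map_mul]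
    exact mul_mem_homog hα hβ
  | single j k =>
    rw [← MvPolynomial.X_pow_eq_monomial, map_pow, Finsupp.degree_single, ev_X]
    simpa using pow_mem_homog (of_mem_homog 1 _) k

/-- A homogeneous element is a combination of the basis elements of the same degree. -/
theorem mem_span_of_mem_homog {J : Type} (B : Module.Basis J (ZMod 2) (HStar K)) {deg : J → ℕ}
    (hB : ∀ j, B j ∈ homog K (deg j)) {m : ℕ} {z : HStar K} (hz : z ∈ homog K m) :
    z ∈ Submodule.span (ZMod 2) (B '' {j | deg j = m}) := by
  let π : HStar K →ₗ[ZMod 2] HStar K :=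
    (DirectSum.lof (ZMod 2) ℕ (H K) m).comp (DirectSum.component (ZMod 2) ℕ (H K) m)
  have hπ : ∀ m' (y : H K m'), π (DirectSum.of (H K) m' y) =
      if m' = m then DirectSum.of (H K) m' y else 0 := by
    intro m' y
    change DirectSum.of (H K) m (DirectSum.of (H K) m' y m) = _
    by_cases h : m' = m
    · subst h
      rw [DirectSum.of_eq_same, if_pos rfl]
    · rw [of_apply_of_ne h, if_neg h, map_zero]
  have h1 : LinearMap.range π ≤ Submodule.span (ZMod 2) (B '' {j | deg j = m}) := by
    rw [LinearMap.range_eq_map, ← B.span_eq, Submodule.map_span, Submodule.span_le]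
    rintro _ ⟨_, ⟨j, rfl⟩, rfl⟩
    obtain ⟨y, hy⟩ := exists_of_mem_homog (hB j)
    rw [hy, hπ]
    split_ifs with h
    · rw [← hy]
      exact Submodule.subset_span ⟨j, h, rfl⟩
    · exact zero_mem _
  obtain ⟨y, rfl⟩ := exists_of_mem_homog hz
  exact h1 ⟨DirectSum.of (H K) m y, by rw [hπ, if_pos rfl]⟩

theorem exists_homogeneous_basis (G : Type) [Group G] :
    ∃ (κ : ℕ → Type) (b : Module.Basis (Σ d, κ d) (ZMod 2) (HStar G)),
      ∀ i, b i ∈ homog G i.1 := by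
  classical
  let c := fun d => Module.Basis.ofVectorSpace (ZMod 2) (H G d)
  refine ⟨_, DFinsupp.basis c, fun ⟨d, k⟩ => ?_⟩
  have : (DFinsupp.basis c ⟨d, k⟩ : HStar G) = DirectSum.of (H G) d (c d k) := by
    change (DFinsupp.mapRange.linearEquiv fun i => (c i).repr).symm
      (sigmaFinsuppEquivDFinsupp (Finsupp.single ⟨d, k⟩ 1)) = _
    rw [sigmaFinsuppEquivDFinsupp_single, LinearEquiv.symm_apply_eq]
    refine Eq.trans ?_ (DFinsupp.mapRange_single (f := fun i => (c i).repr)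
      (hf := fun i => map_zero _)).symm
    rw [Module.Basis.repr_self]
  rw [this]
  exact of_mem_homog _ _

end Homogeneous

/-! ### Trivial homomorphisms and the cohomology of elementary abelian groups -/

section TrivialMap

variable {G K : Type} [Group G] [Group K]

/-- The trivial homomorphism factors through the trivial group, which has no cohomology in positive
degrees. -/
theorem mapDeg_one (d : ℕ) (hd : 0 < d) (y : H G d) : mapDeg (1 : K →* G) d y = 0 := by
  have h1 : Subsingleton (H Unit d) := by
    obtain ⟨d, rfl⟩ := Nat.exists_eq_succ_of_ne_zero hd.ne'
    exact ModuleCat.subsingleton_of_isZero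
      (isZero_groupCohomology_succ_of_subsingleton (trivialRep Unit) d)
  have h2 := map_map (1 : Unit →* G) (1 : K →* Unit) (DirectSum.of (H G) d y)
  rw [map_of, map_of, map_of, Subsingleton.elim (mapDeg (1 : Unit →* G) d y) 0, _root_.map_zero,
    _root_.map_zero] at h2
  exact DirectSum.of_injective d (h2.symm.trans (_root_.map_zero _).symm)

/-- The cohomology of the trivial group is one-dimensional. -/
theorem exists_basis_unit : ∃ b : Module.Basis Unit (ZMod 2) (HStar Unit), ∀ k, b k = 1 := by
  have hinj : Function.Injective (LinearMap.toSpanSingleton (ZMod 2) (HStar Unit) 1) := by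
    rw [injective_iff_map_eq_zero]
    intro r hr
    have h1 : DirectSum.of (H Unit) 0 (degZeroEquiv Unit r) = 0 := by
      rw [of_zero_eq_algebraMap, LinearEquiv.symm_apply_apply, Algebra.algebraMap_eq_smul_one]
      exact hr
    have h2 := DirectSum.of_injective 0 (h1.trans (map_zero _).symm)
    exact (map_eq_zero_iff _ (degZeroEquiv Unit).injective).1 h2
  have hsurj : Function.Surjective (LinearMap.toSpanSingleton (ZMod 2) (HStar Unit) 1) := by
    intro z
    refine ⟨(degZeroEquiv Unit).symm (z 0), ?_⟩
    rw [LinearMap.toSpanSingleton_apply, ← Algebra.algebraMap_eq_smul_one, ← of_zero_eq_algebraMap]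
    refine DFinsupp.ext fun d => ?_
    rcases Nat.eq_zero_or_pos d with rfl | hd
    · exact DirectSum.of_eq_same _ _
    · have : Subsingleton (H Unit d) := by
        obtain ⟨d, rfl⟩ := Nat.exists_eq_succ_of_ne_zero hd.ne'
        exact ModuleCat.subsingleton_of_isZero
          (isZero_groupCohomology_succ_of_subsingleton (trivialRep Unit) d)
      exact Subsingleton.elim _ _
  refine ⟨(Module.Basis.singleton Unit (ZMod 2)).map (LinearEquiv.ofBijective _ ⟨hinj, hsurj⟩),
    fun k => ?_⟩
  rw [Module.Basis.map_apply, Module.Basis.singleton_apply]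
  exact one_smul (ZMod 2) (1 : HStar Unit)

/-- The coordinates of an elementary abelian group. -/
def coordV (n : ℕ) (j : Fin n) : (Fin n → C2) →* C2 := Pi.evalMonoidHom (fun _ : Fin n => C2) j

/-- The Künneth basis over the trivial group consists of the monomials; the evaluation there factors
through the one in question. -/
theorem ev_coordV_injective (n : ℕ) : Function.Injective (ev (coordV n)) := by
  obtain ⟨b, hb⟩ := exists_basis_unit
  obtain ⟨B, hB⟩ := exists_basis_power n Unit b
  have h1 : (ev (coord n Unit)).toLinearMap =
      ((MvPolynomial.basisMonomials (Fin n) (ZMod 2)).equiv B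
        (Equiv.prodUnique (Fin n →₀ ℕ) Unit).symm).toLinearMap := by
    refine (MvPolynomial.basisMonomials (Fin n) (ZMod 2)).ext fun α => ?_
    rw [LinearEquiv.coe_coe, Module.Basis.equiv_apply]
    refine Eq.trans ?_ (hB α default).symm
    rw [hb, _root_.map_one (map _), mul_one, MvPolynomial.coe_basisMonomials]
    rfl
  have h2 : Function.Injective (ev (coord n Unit)) := by
    change Function.Injective (ev (coord n Unit)).toLinearMap
    rw [h1]
    exact LinearEquiv.injective _
  have h3 : (ev (coord n Unit) : _ → _) = map (MonoidHom.fst _ _) ∘ ev (coordV n) := by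
    funext p
    rw [Function.comp_apply, map_ev]
    rfl
  rw [h3] at h2
  exact h2.of_comp

end TrivialMap

/-! ### The filtration by degree in the second factor -/

section Filtration

variable {n : ℕ} {G : Type} [Group G] {κ : ℕ → Type}
  {b : Module.Basis (Σ d, κ d) (ZMod 2) (HStar G)} (hb : ∀ i, b i ∈ homog G i.1)
  {B : Module.Basis ((Fin n →₀ ℕ) × Σ d, κ d) (ZMod 2) (HStar ((Fin n → C2) × G))}
  (hB : ∀ α k, B (α, k) = ev (coord n G) (MvPolynomial.monomial α 1) *
    map (MonoidHom.snd _ _) (b k))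

/-- The span of the basis elements of total degree `m` and of degree at least `D` in the factor
`G`. -/
def filt (B : Module.Basis ((Fin n →₀ ℕ) × Σ d, κ d) (ZMod 2) (HStar ((Fin n → C2) × G)))
    (m D : ℕ) : Submodule (ZMod 2) (HStar ((Fin n → C2) × G)) :=
  Submodule.span (ZMod 2) (B '' {j | j.1.degree + j.2.1 = m ∧ D ≤ j.2.1})

include hb hB

theorem homog_le_filt (m : ℕ) : homog ((Fin n → C2) × G) m ≤ filt B m 0 := by
  intro z hz
  have h1 := mem_span_of_mem_homog B (deg := fun j => j.1.degree + j.2.1)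
    (fun j => by
      rw [← Prod.mk.eta (p := j), hB]
      exact mul_mem_homog (ev_monomial_mem_homog _ _) (map_mem_homog _ (hb _))) hz
  exact Submodule.span_mono (Set.image_mono fun j hj =>
    (⟨hj, Nat.zero_le _⟩ : _ ∧ _)) h1

theorem monomial_mul_mem_filt (α : Fin n →₀ ℕ) {d D : ℕ} (hD : D ≤ d) {w : HStar G}
    (hw : w ∈ homog G d) :
    ev (coord n G) (MvPolynomial.monomial α 1) * map (MonoidHom.snd _ _) w ∈
      filt B (α.degree + d) D := by
  have h1 := mem_span_of_mem_homog b hb hw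
  clear hw
  induction h1 using Submodule.span_induction with
  | mem z hz =>
    obtain ⟨j, hj, rfl⟩ := hz
    rw [← hB]
    obtain rfl : j.1 = d := hj
    exact Submodule.subset_span ⟨(α, j), ⟨rfl, hD⟩, rfl⟩
  | zero => rw [map_zero, mul_zero]; exact zero_mem _
  | add x y _ _ hx hy => rw [map_add, mul_add]; exact add_mem hx hy
  | smul r x _ hx => rw [map_smul, mul_smul_comm]; exact Submodule.smul_mem _ r hx

theorem mul_mem_filt {m m' D D' : ℕ} {z z' : HStar ((Fin n → C2) × G)} (hz : z ∈ filt B m D)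
    (hz' : z' ∈ filt B m' D') : z * z' ∈ filt B (m + m') (D + D') := by
  have h1 : filt B m D * filt B m' D' ≤ filt B (m + m') (D + D') := by
    rw [filt, filt, Submodule.span_mul_span, Submodule.span_le]
    rintro _ ⟨_, ⟨⟨α, i⟩, ⟨h1, h2⟩, rfl⟩, _, ⟨⟨β, j⟩, ⟨h3, h4⟩, rfl⟩, rfl⟩
    have h5 := monomial_mul_mem_filt hb hB (α + β) (add_le_add h2 h4)
      (mul_mem_homog (hb i) (hb j))
    have h6 : ev (coord n G) (MvPolynomial.monomial (α + β) 1) *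
        map (MonoidHom.snd _ _) (b i * b j) = B (α, i) * B (β, j) := by
      rw [hB, hB, ← mul_one (1 : ZMod 2), ← MvPolynomial.monomial_mul, map_mul, map_mul, mul_one,
        (ev_commute (coord n G) (MvPolynomial.monomial β 1)
          (map (MonoidHom.snd _ _) (b i))).symm.mul_mul_mul_comm]
    rw [h6] at h5
    have h7 : (α + β).degree + (i.1 + j.1) = m + m' := by
      rw [map_add, ← h1, ← h3]
      ring
    rwa [h7] at h5
  exact h1 (Submodule.mul_mem_mul hz hz')

/-- Basis elements of degree zero in `G` are scalar multiples of monomials, because `H⁰(G; 𝔽₂)` is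
spanned by the unit. -/
theorem exists_sub_mem_filt {m : ℕ} {z : HStar ((Fin n → C2) × G)}
    (hz : z ∈ filt B m 0) : ∃ a, z - ev (coord n G) a ∈ filt B m 1 := by
  induction hz using Submodule.span_induction with
  | mem z hz =>
    obtain ⟨⟨α, ⟨d, k⟩⟩, ⟨hj, -⟩, rfl⟩ := hz
    rcases Nat.eq_zero_or_pos d with rfl | hd
    · obtain ⟨y, hy⟩ := exists_of_mem_homog (hb ⟨0, k⟩)
      rw [hB, hy, of_zero_eq_algebraMap, AlgHom.commutes, Algebra.algebraMap_eq_smul_one,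
        mul_smul_comm, mul_one, ← map_smul]
      exact ⟨_, by rw [sub_self]; exact zero_mem _⟩
    · exact ⟨0, by
        rw [map_zero, sub_zero]
        exact Submodule.subset_span ⟨_, ⟨hj, hd⟩, rfl⟩⟩
  | zero => exact ⟨0, by rw [map_zero, sub_zero]; exact zero_mem _⟩
  | add x y _ _ hx hy =>
    obtain ⟨a, ha⟩ := hx
    obtain ⟨a', ha'⟩ := hy
    exact ⟨a + a', by rw [map_add, add_sub_add_comm]; exact add_mem ha ha'⟩
  | smul r x _ hx =>
    obtain ⟨a, ha⟩ := hx
    exact ⟨r • a, by rw [map_smul, ← smul_sub]; exact Submodule.smul_mem _ r ha⟩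

theorem map_inl_eq_zero {m : ℕ} {z : HStar ((Fin n → C2) × G)} (hz : z ∈ filt B m 1) :
    map (MonoidHom.inl (Fin n → C2) G) z = 0 := by
  induction hz using Submodule.span_induction with
  | mem z hz =>
    obtain ⟨⟨α, ⟨d, k⟩⟩, ⟨-, hd⟩, rfl⟩ := hz
    obtain ⟨y, hy⟩ := exists_of_mem_homog (hb ⟨d, k⟩)
    rw [hB, hy, map_mul, map_map, MonoidHom.snd_comp_inl, map_of, mapDeg_one d hd, map_zero,
      mul_zero]
  | zero => exact map_zero _
  | add x y _ _ hx hy => rw [map_add, hx, hy, add_zero]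
  | smul r x _ hx => rw [map_smul, hx, smul_zero]

/-- The leading term of `z` is a polynomial, and restriction to the elementary abelian factor
detects it: this restriction kills positive degree in `G` and is injective on polynomials. -/
theorem sub_ev_mem_filt {m : ℕ} {z : HStar ((Fin n → C2) × G)}
    (hz : z ∈ homog ((Fin n → C2) × G) m) {c : MvPolynomial (Fin n) (ZMod 2)}
    (hc : map (MonoidHom.inl (Fin n → C2) G) z = ev (coordV n) c) :
    z - ev (coord n G) c ∈ filt B m 1 := by
  obtain ⟨a, ha⟩ := exists_sub_mem_filt hb hB (homog_le_filt hb hB m hz)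
  have h1 := map_inl_eq_zero hb hB ha
  rw [map_sub, hc, map_ev, sub_eq_zero] at h1
  have h2 : c = a := ev_coordV_injective n h1
  rwa [h2]

end Filtration

/-! ### Projectivity from the multiplication homomorphism -/

section Projective

variable {n : ℕ} {G : Type} [Group G]

/-- The multiplication homomorphism of a central elementary abelian subgroup. -/
def mulHom (φ : (Fin n → C2) →* G) (hφ : ∀ v g, Commute (φ v) g) : (Fin n → C2) × G →* G :=
  MonoidHom.noncommCoprod φ (MonoidHom.id G) hφ

theorem divModEquiv_apply (q : ℕ) [NeZero q] (β : Fin n → Fin q) (γ : Fin n →₀ ℕ) :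
    Finsupp.divModEquiv n q (β, γ) =
      q • γ + Finsupp.equivFunOnFinite.symm fun j => (β j : ℕ) := by
  ext j
  simp [Finsupp.divModEquiv]

/-- Regrouping of the index set of a monomial basis after division with remainder. -/
def regroupEquiv (n q : ℕ) [NeZero q] (κ : Type) :
    (Σ _ : (Fin n → Fin q) × κ, Fin n →₀ ℕ) ≃ (Fin n →₀ ℕ) × κ where
  toFun a := (Finsupp.divModEquiv n q (a.1.1, a.2), a.1.2)
  invFun a := ⟨(((Finsupp.divModEquiv n q).symm a.1).1, a.2), ((Finsupp.divModEquiv n q).symm a.1).2⟩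
  left_inv a := by simp
  right_inv a := by simp

/-- The cohomology of `G` is a retract of that of the product, on which `P` acts through `θ`. There
the basis is triangular against the products of `P` with the `x^β b_k`, `β` having all exponents
below `q`. -/
theorem projective_of_central {φ : (Fin n → C2) →* G} (hφ : ∀ v g, Commute (φ v) g) (q : ℕ)
    [NeZero q] (P : Subalgebra (ZMod 2) (HStar G)) (ψ : MvPolynomial (Fin n) (ZMod 2) ≃ₐ[ZMod 2] P)
    (hψ : ∀ c, map φ (ψ c : HStar G) = ev (coordV n) (MvPolynomial.expand q c))
    (hdeg : ∀ γ : Fin n →₀ ℕ,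
      (ψ (MvPolynomial.monomial γ 1) : HStar G) ∈ homog G (q * γ.degree)) :
    Module.Projective P (HStar G) := by
  obtain ⟨κ, b, hb⟩ := exists_homogeneous_basis G
  obtain ⟨B, hB⟩ := exists_basis_power n G b
  let θ : HStar G →ₐ[ZMod 2] HStar ((Fin n → C2) × G) := map (mulHom φ hφ)
  have hinl : ∀ z, map (MonoidHom.inl (Fin n → C2) G) (θ z) = map φ z := fun z => by
    rw [map_map]
    congr 1
    exact congrArg map (MonoidHom.ext fun v => by simp [mulHom])
  have hinr : ∀ z, map (MonoidHom.inr (Fin n → C2) G) (θ z) = z := fun z => by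
    rw [map_map, show (mulHom φ hφ).comp (MonoidHom.inr (Fin n → C2) G) = MonoidHom.id G from
      MonoidHom.ext fun g => by simp [mulHom], map_id]
  let : Module P (HStar ((Fin n → C2) × G)) := Module.compHom _ (θ.comp P.val).toRingHom
  have hsmul : ∀ (p : P) (z : HStar ((Fin n → C2) × G)), p • z = θ p * z := fun _ _ => rfl
  have : IsScalarTower (ZMod 2) P (HStar ((Fin n → C2) × G)) := ⟨fun r p z => by
    rw [hsmul, hsmul, ← smul_mul_assoc, ← map_smul]
    rfl⟩
  have hfree : Module.Free P (HStar ((Fin n → C2) × G)) := by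
    refine Module.Free.of_triangular
      ((MvPolynomial.basisMonomials (Fin n) (ZMod 2)).map ψ.toLinearEquiv) B
      (regroupEquiv n q (Σ d, κ d))
      (fun i => ev (coord n G) (MvPolynomial.monomial
        (Finsupp.equivFunOnFinite.symm fun j => (i.1 j : ℕ)) 1) * map (MonoidHom.snd _ _) (b i.2))
      (fun j => j.1.degree + j.2.1) (fun j => j.2.1) (fun j => Nat.le_add_left _ _) ?_
    rintro ⟨β, k⟩ γ
    set β' : Fin n →₀ ℕ := Finsupp.equivFunOnFinite.symm fun j => (β j : ℕ) with hβ'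
    have he : regroupEquiv n q (Σ d, κ d) ⟨(β, k), γ⟩ = (q • γ + β', k) := by
      rw [← divModEquiv_apply]
      rfl
    rw [he, hsmul, hB, Module.Basis.map_apply, MvPolynomial.coe_basisMonomials]
    -- Division of exponents by `q`: the first factor is the leading term of `θ` on the basis
    -- element of `P` indexed by `γ`, so the difference in question is `θ p` minus its leading term,
    -- times `x^β b_k`.
    have h1 : MvPolynomial.monomial (q • γ + β') (1 : ZMod 2) =
        MvPolynomial.expand q (MvPolynomial.monomial γ 1) * MvPolynomial.monomial β' 1 := by
      rw [MvPolynomial.expand_monomial, MvPolynomial.monomial_mul, mul_one]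
    rw [h1, map_mul, mul_assoc, ← sub_mul]
    have h2 := sub_ev_mem_filt hb hB (map_mem_homog (mulHom φ hφ) (hdeg γ))
      ((hinl _).trans (hψ _))
    have h3 := mul_mem_filt hb hB h2
      (monomial_mul_mem_filt hb hB β' (le_refl k.1) (hb k))
    refine Submodule.span_mono (Set.image_mono ?_) h3
    rintro j ⟨h4, h5⟩
    refine (⟨?_, by simpa [Nat.add_comm 1, Nat.succ_le_iff] using h5⟩ : _ ∧ _)
    simp only [map_add, map_nsmul, smul_eq_mul]
    omega
  let i₁ : HStar G →ₗ[P] HStar ((Fin n → C2) × G) :=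
    { toFun := θ
      map_add' := map_add θ
      map_smul' := fun p z => map_mul θ (p : HStar G) z }
  let i₂ : HStar ((Fin n → C2) × G) →ₗ[P] HStar G :=
    { toFun := map (MonoidHom.inr (Fin n → C2) G)
      map_add' := map_add _
      map_smul' := fun p z => by
        rw [hsmul, map_mul, hinr]
        rfl }
  exact Module.Projective.of_split i₁ i₂ (LinearMap.ext hinr)

end Projective

/-! ### Coordinates on the center and the conclusion -/

section Center

variable {Z : Type}

/-- There are no nonzero coboundaries in degree one. -/
theorem cls_degOne_eq_zero [Group Z] {f : Cochain Z 1} (hf : d f = 0) (h : cls f hf = 0) :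
    f = 0 := by
  rw [cls_eq_zero_iff] at h
  obtain ⟨e, rfl⟩ := h
  refine ext_inj fun s => ?_
  rw [ext_d, show Finset.range (0 + 1) = Finset.range 1 from rfl, Finset.sum_range_one, ext_contract_add e s le_rfl,
    ext_congr e (s := shift 1 s) (s' := s) fun i hi => absurd hi (Nat.not_lt_zero i), add_self_zmod]
  rfl

theorem map_mul_of_d_eq_zero [Group Z] {f : Cochain Z 1} (hf : d f = 0) (a b : Z) :
    f (fun _ => a * b) = f (fun _ => a) + f (fun _ => b) := by
  have h := congrArg (fun g => ext g fun i => if i = 0 then a else b) hf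
  simp only [ext_d, Finset.sum_range_succ, Finset.sum_range_zero, zero_add] at h
  have h1 : ∀ s : ℕ → Z, ext f s = f fun _ => s 0 := fun s => by
    unfold ext
    congr 1
    funext i
    rw [Subsingleton.elim i 0]
    rfl
  simp only [h1, shift, contract] at h
  simp at h
  change _ = ext (0 : Cochain Z 2) _ at h
  change _ = (0 : ZMod 2) at h
  linear_combination -h + add_self_zmod (f fun _ => a * b)

/-- An elementary abelian group is a product of groups of order two, with coordinates given by a
basis of its degree one cohomology. -/
theorem exists_mulEquiv [Group Z] (hcomm : ∀ a b : Z, a * b = b * a)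
    (hZ : ∀ z : Z, z ^ 2 = 1) {n : ℕ} [Finite Z]
    (x : Module.Basis (Fin n) (ZMod 2) (H Z 1)) :
    ∃ e : (Fin n → C2) ≃* Z, ∀ j, map e.toMonoidHom (DirectSum.of (H Z) 1 (x j)) =
      ev (coordV n) (MvPolynomial.X j) := by
  let : CommGroup Z := { ‹Group Z› with mul_comm := hcomm }
  let : Module (ZMod 2) (Additive Z) := AddCommGroup.zmodModule hZ
  -- Degree one classes are homomorphisms to `𝔽₂`, that is, linear forms on `Z`, so `x` becomes a
  -- basis `y` of the dual space.
  let T : Module.Dual (ZMod 2) (Additive Z) →ₗ[ZMod 2] H Z 1 :=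
    { toFun := fun f => homClass (fun z => f (Additive.ofMul z)) fun a b => by simp
      map_add' := fun f g => cls_add _ _
      map_smul' := fun r f => cls_smul r _ }
  have hT : Function.Bijective T := by
    constructor
    · rw [injective_iff_map_eq_zero]
      intro f hf
      have h1 := cls_degOne_eq_zero _ hf
      exact LinearMap.ext fun z => congrFun h1 fun _ => z.toMul
    · intro y
      obtain ⟨f, hf, rfl⟩ := cls_surj y
      let f' : Additive Z →+ ZMod 2 := AddMonoidHom.mk' (fun z => f fun _ => z.toMul)
        fun a b => map_mul_of_d_eq_zero hf _ _
      refine ⟨f'.toZModLinearMap 2, ?_⟩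
      change cls _ _ = cls _ _
      congr 1
      funext s
      change f _ = f s
      congr 1
      funext i
      rw [Subsingleton.elim i 0]
      rfl
  let T' := LinearEquiv.ofBijective T hT
  let y := x.map T'.symm
  have : Finite (Additive Z) := ‹Finite Z›
  have : Module.Finite (ZMod 2) (Additive Z) := Module.Finite.of_finite
  -- Coordinates on `Z` whose linear forms are the `y j`: the bidual identification followed by the
  -- basis dual to `y`.
  let E : Additive Z ≃ₗ[ZMod 2] (Fin n → ZMod 2) :=
    (Module.evalEquiv (ZMod 2) (Additive Z)).trans y.dualBasis.equivFun
  have hE : ∀ z j, E z j = y j z := fun z j => by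
    change y.dualBasis.equivFun (Module.Dual.eval (ZMod 2) (Additive Z) z) j = _
    simp [Module.Basis.dualBasis_equivFun]
  let e : (Fin n → C2) ≃* Z :=
    { toFun := fun v => (E.symm fun j => (v j).toAdd).toMul
      invFun := fun z j => Multiplicative.ofAdd (E (Additive.ofMul z) j)
      left_inv := fun v => by simp
      right_inv := fun z => by
        change (E.symm (E (Additive.ofMul z))).toMul = z
        rw [E.symm_apply_apply]
        rfl
      map_mul' := fun v w => by
        change (E.symm ((fun j => (v j).toAdd) + fun j => (w j).toAdd)).toMul = _
        rw [map_add]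
        rfl }
  refine ⟨e, fun j => ?_⟩
  have h1 : x j = T (y j) := by
    change x j = T' (T'.symm (x j))
    rw [LinearEquiv.apply_symm_apply]
  rw [h1, ev_X]
  refine (map_of_homClass (χ := fun z => y j (Additive.ofMul z)) e.toMonoidHom
    fun a b => map_add (y j) _ _).trans ?_
  congr 2
  funext v
  change y j (E.symm fun j => (v j).toAdd) = _
  rw [← hE, LinearEquiv.apply_symm_apply]
  rfl

end Center

/-- A graded subalgebra of the cohomology of `G` that is mapped isomorphically onto
`𝔽₂[x₁^{2^l}, …, xₙ^{2^l}]` by the restriction to an elementary abelian center acts freely. -/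
theorem free_of_bijOn_res (G : Type) [Group G] [Finite G]
    (hZ : ∀ z ∈ Subgroup.center G, z ^ 2 = 1)
    (n : ℕ) (x : Module.Basis (Fin n) (ZMod 2) (H (Subgroup.center G) 1))
    (l : ℕ) (P : Subalgebra (ZMod 2) (HStar G)) (hP : IsGraded P)
    (hres : Set.BijOn (res (Subgroup.center G)) P (powerSubalgebra x l)) :
    Module.Free P (HStar G) := by
  obtain ⟨e, he⟩ := exists_mulEquiv (Z := Subgroup.center G)
    (fun a b => Subtype.ext (Subgroup.mem_center_iff.1 b.2 a)) (fun z => Subtype.ext (hZ z z.2)) x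
  have hq : 0 < 2 ^ l := by positivity
  let φ : (Fin n → C2) →* G := (Subgroup.center G).subtype.comp e.toMonoidHom
  have hφ : ∀ v g, Commute (φ v) g := fun v g =>
    (Subgroup.mem_center_iff.1 (e v).2 g).symm
  have hφres : ∀ z, map φ z = map e.toMonoidHom (res (Subgroup.center G) z) := fun z =>
    (map_map _ _ z).symm
  have heinj : Function.Injective (map e.toMonoidHom) := by
    refine Function.LeftInverse.injective (g := map e.symm.toMonoidHom) fun z => ?_
    rw [map_map, show e.toMonoidHom.comp e.symm.toMonoidHom = MonoidHom.id _ from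
      MonoidHom.ext fun z => e.apply_symm_apply z, map_id]
  -- Polynomials, by `x_j ↦ x_j^{2^l}`, and `P`, by restriction, both embed in the cohomology of the
  -- elementary abelian group with the same image. This gives the isomorphism `ψ`.
  let f₁ : MvPolynomial (Fin n) (ZMod 2) →ₐ[ZMod 2] HStar (Fin n → C2) :=
    (ev (coordV n)).comp (MvPolynomial.expand (2 ^ l))
  let f₂ : P →ₐ[ZMod 2] HStar (Fin n → C2) := (map φ).comp P.val
  have h₁ : Function.Injective f₁ :=
    (ev_coordV_injective n).comp (MvPolynomial.expand_injective hq)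
  have h₂ : Function.Injective f₂ := fun p p' h => by
    change map φ (p : HStar G) = map φ (p' : HStar G) at h
    rw [hφres, hφres] at h
    exact Subtype.ext (hres.injOn p.2 p'.2 (heinj h))
  have hadj : f₁.range = (powerSubalgebra x l).map (map e.toMonoidHom) := by
    rw [powerSubalgebra, AlgHom.map_adjoin, ← Algebra.map_top, ← MvPolynomial.adjoin_range_X,
      AlgHom.map_adjoin, ← Set.range_comp, ← Set.range_comp]
    congr 2
    funext j
    simp only [Function.comp_apply, map_pow, he]
    simp [f₁]
  have hrange : f₁.range = f₂.range := by
    rw [hadj]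
    ext z
    constructor
    · rintro ⟨w, hw, rfl⟩
      obtain ⟨p, hp, rfl⟩ := hres.surjOn hw
      exact ⟨⟨p, hp⟩, hφres p⟩
    · rintro ⟨p, rfl⟩
      exact ⟨_, hres.mapsTo p.2, (hφres p).symm⟩
  let ψ : MvPolynomial (Fin n) (ZMod 2) ≃ₐ[ZMod 2] P :=
    (AlgEquiv.ofInjective f₁ h₁).trans ((Subalgebra.equivOfEq _ _ hrange).trans
      (AlgEquiv.ofInjective f₂ h₂).symm)
  have hψ : ∀ c, map φ (ψ c : HStar G) = ev (coordV n) (MvPolynomial.expand (2 ^ l) c) :=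
    fun c => by
      have h3 : AlgEquiv.ofInjective f₂ h₂ (ψ c) =
          Subalgebra.equivOfEq _ _ hrange (AlgEquiv.ofInjective f₁ h₁ c) :=
        (AlgEquiv.ofInjective f₂ h₂).apply_symm_apply _
      exact congrArg Subtype.val h3
  have hdeg : ∀ γ : Fin n →₀ ℕ,
      (ψ (MvPolynomial.monomial γ 1) : HStar G) ∈ homog G (2 ^ l * γ.degree) := fun γ => by
    set p := ψ (MvPolynomial.monomial γ 1) with hp
    have h3 := hψ (MvPolynomial.monomial γ 1)
    rw [MvPolynomial.expand_monomial] at h3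
    have h4 := ev_monomial_mem_homog (coordV n) (2 ^ l • γ)
    rw [map_nsmul, smul_eq_mul, ← h3] at h4
    obtain ⟨y, hy⟩ := exists_of_mem_homog h4
    -- Restriction is injective on `P`, and `P` contains the components of `p`. Since `p` restricts
    -- to a homogeneous element, `p` equals its component of that degree.
    have h5 : DirectSum.of (H G) (2 ^ l * γ.degree) ((p : HStar G) (2 ^ l * γ.degree)) = p := by
      have h6 := @h₂ ⟨_, hP p p.2 (2 ^ l * γ.degree)⟩ p (by
        change map φ (DirectSum.of (H G) _ _) = map φ (p : HStar G)
        rw [map_of, ← map_apply, hy, DirectSum.of_eq_same])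
      exact congrArg Subtype.val h6
    rw [← h5]
    exact of_mem_homog _ _
  have : NeZero (2 ^ l) := ⟨hq.ne'⟩
  have := projective_of_central hφ (2 ^ l) P ψ hψ hdeg
  exact free_of_projective hP

end ModTwo

end

theorem lemma3p1 (G : Type) [Group G] [Finite G] (hG : IsPGroup 2 G)
    (hZ : ∀ z ∈ Subgroup.center G, z ^ 2 = 1)
    (n : ℕ) (x : Module.Basis (Fin n) (ZMod 2) (ModTwo.H (Subgroup.center G) 1))
    (l : ℕ) (P : Subalgebra (ZMod 2) (ModTwo.HStar G)) (hP : ModTwo.IsGraded P)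
    (hres : Set.BijOn (ModTwo.res (Subgroup.center G)) P (ModTwo.powerSubalgebra x l)) :
    Module.Free P (ModTwo.HStar G) := by
  exact ModTwo.free_of_bijOn_res G hZ n x l P hP hres
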